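/- Let $d=1$. For $k\ge 1$ let a $k$-particle kernel be a function $\gamma^{(k)}(x_1,\dots,x_k;x_1',\dots,x_k')$ in $L^2(\mathbb R^k\times\mathbb R^k;\mathbb C)$, and put $$S^{(k,\alpha)}=\prod_{j=1}^k(1-\Delta_{x_j})^{\alpha/2}(1-\Delta_{x_j'})^{\alpha/2},\qquad \mathcal U^{(k)}(t)=e^{it(\Delta_{\mathbf x_k}-\Delta_{\mathbf x_k'})}.$$ For $1\le j\le k$ and $p\ge1$ let $B_{j;k+1,\dots,k+p}=B^+_{j;k+1,\dots,k+p}-B^-_{j;k+1,\dots,k+p}$, where $$(B^+_{j;k+1,\dots,k+p}\gamma^{(k+p)})(\mathbf x_k;\mathbf x_k')=\gamma^{(k+p)}(\mathbf x_k,x_j,\dots,x_j;\mathbf x_k',x_j,\dots,x_j)$$ and $B^-$ is the same with $x_j'$ in place of the inserted $x_j$. (These are evaluated on the continuous representative, which exists when $S^{(k+p,\alpha)}\gamma^{(k+p)}\in L^2$ for some $\alpha>1/2$.) For $p_0\ge 1$ and constants $b_0^{(1)},\dots,b_0^{(p_0)}\ge 0$, a solution on $[0,T]$ of the Gross–Pitaevskii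 hierarchy is a family $\Gamma=(\gamma^{(k)}(t))_{k\ge1,\,t\in[0,T]}$ with $S^{(k,\alpha)}\gamma^{(k)}(t)\in L^2$ and, for all $k\ge1$ and $t\in[0,T]$, $$\gamma^{(k)}(t)=\mathcal U^{(k)}(t)\gamma^{(k)}(0)-i\sum_{p=1}^{p_0}b_0^{(p)}\sum_{j=1}^k\int_0^t\mathcal U^{(k)}(t-s)B_{j;k+1,\dots,k+p}\gamma^{(k+p)}(s)\,ds,$$ where the integrals are Bochner integrals in $L^2$ of integrable functions. For $K>0$ consider two classes of families on $[0,T]$: (a) $\|S^{(k,\alpha)}\gamma^{(k)}(t)\|_{L^2}\le K^k$ for all $k\ge 1$, $t\in[0,T]$; (b) every $\gamma^{(k)}(t)$ is the kernel of a non-negative operator with $\mathrm{Tr}\,(1-\Delta_{x_1})\cdots(1-\Delta_{x_k})\gamma^{(k)}(t)\le K^k$, for all $k\ge1$, $t\in[0,T]$. **Theorem 5.1.** Let $d=1$, $\frac12<\alpha\le1$, $p_0\ge1$, $b_0\in(0,\infty)$ and $K>0$. There are constants $C,C_0>0$, depending only on $b_0$, $p_0$, $\alpha$ and $K$, such that for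 all $b_0^{(1)},\dots,b_0^{(p_0)}\ge0$ with maximum $b_0$ and all $T>0$ the following holds. 1. Let $\Gamma$ be a solution on $[0,T]$ in class (a) with $\gamma^{(k)}(0)=0$ for all $k\ge1$. Then $$\|S^{(k,\alpha)}\gamma^{(k)}(t)\|_{L^2(\mathbb R^k\times\mathbb R^k)}\le C^k(C_0T)^n\qquad\text{for all }k\ge1,\ t\in[0,T],\ n\ge0.$$ Hence, if $C_0T<1$, then $\gamma^{(k)}(t)=0$ for all $k\ge1$ and $t\in[0,T]$. 2. Let $\Gamma_1,\Gamma_2$ be two solutions on $[0,T]$ with the same initial data, either both in class (a) or both in class (b). Then $$\|S^{(k,\alpha)}(\gamma_1^{(k)}(t)-\gamma_2^{(k)}(t))\|_{L^2(\mathbb R^k\times\mathbb R^k)}\le C^k(C_0T)^n\qquad\text{for all }k\ge1,\ t\in[0,T],\ n\ge0.$$ Hence, if $C_0T<1$, then $\gamma_1^{(k)}(t)=\gamma_2^{(k)}(t)$ for all $k\ge1$ and $t\in[0,T]$. -/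

import Mathlib

open MeasureTheory FourierTransform

noncomputable section

namespace GPHierarchy

/-- `L²(ℝ^ι; ℂ)` for a finite index set `ι`.  A `k`-particle kernel `γ(x₁,…,x_k; x'₁,…,x'_k)` on the
line is an element of `L2 (Fin k ⊕ Fin k)`: the coordinate `Sum.inl i` is the unprimed variable of
particle `i` and `Sum.inr i` is its primed variable. -/
abbrev L2 (ι : Type) [Fintype ι] : Type := Lp (α := EuclideanSpace ℝ ι) ℂ 2 volume

/-- Square integrable kernels of `k` particles in one space dimension. -/
abbrev Kernel (k : ℕ) : Type := L2 (Fin k ⊕ Fin k)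

section Multipliers

variable {ι : Type} [Fintype ι]

/-- `g` lies in the domain of the Fourier multiplier with symbol `m`. -/
def InDomain (m : EuclideanSpace ℝ ι → ℂ) (g : L2 ι) : Prop :=
  MemLp (fun ξ => m ξ * (𝓕 g : L2 ι) ξ) 2 volume

open Classical in
/-- The Fourier multiplier `g ↦ 𝓕⁻¹ (m · 𝓕 g)` on `L²`, set to `0` outside of its domain. -/
def multiplier (m : EuclideanSpace ℝ ι → ℂ) (g : L2 ι) : L2 ι :=
  if h : InDomain m g then 𝓕⁻ (MemLp.toLp _ h : L2 ι) else 0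

/-- The symbol `∏ᵢ (1 + |2πξᵢ|²)^{α/2}` of `∏ᵢ (1 - ∂ᵢ²)^{α/2}`; the Fourier transform of Mathlib has
the character `e^{-2πi x·ξ}`, so that `-∂ᵢ²` has the symbol `(2πξᵢ)²`. -/
def sobolevSymbol (α : ℝ) (ξ : EuclideanSpace ℝ ι) : ℂ :=
  ((∏ i, (1 + (2 * Real.pi * ξ i) ^ 2) ^ (α / 2) : ℝ) : ℂ)

/-- `g` belongs to the domain of `∏ᵢ (1 - ∂ᵢ²)^{α/2}`, i.e. this expression of `g` is in `L²`. -/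
def InSobolev (α : ℝ) (g : L2 ι) : Prop := InDomain (sobolevSymbol α) g

/-- The operator `∏ᵢ (1 - ∂ᵢ²)^{α/2}`.  On kernels, where `ι = Fin k ⊕ Fin k`, this is
`S^{(k,α)} = ∏ⱼ (1 - Δ_{xⱼ})^{α/2} (1 - Δ_{x'ⱼ})^{α/2}`. -/
def S (α : ℝ) (g : L2 ι) : L2 ι := multiplier (sobolevSymbol α) g

end Multipliers

/-- The symbol `e^{-it(|2πξ|² - |2πξ'|²)}` of `e^{it(Δ_x - Δ_{x'})}`. -/
def evolutionSymbol {k : ℕ} (t : ℝ) (ξ : EuclideanSpace ℝ (Fin k ⊕ Fin k)) : ℂ :=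
  Complex.exp (-Complex.I * t *
    ((∑ i, (2 * Real.pi * ξ (Sum.inl i)) ^ 2 - ∑ i, (2 * Real.pi * ξ (Sum.inr i)) ^ 2 : ℝ) : ℂ))

/-- The free evolution `U^{(k)}(t) = e^{it(Δ_x - Δ_{x'})}`. -/
def U {k : ℕ} (t : ℝ) (γ : Kernel k) : Kernel k := multiplier (evolutionSymbol t) γ

/-- The free evolution is defined on all of `L²`. -/
theorem inDomain_evolutionSymbol {k : ℕ} (t : ℝ) (γ : Kernel k) :
    InDomain (evolutionSymbol t) γ := by
  have hc : Continuous (evolutionSymbol (k := k) t) := by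
    unfold evolutionSymbol
    fun_prop
  refine MemLp.of_le (Lp.memLp (𝓕 γ : Kernel k))
    (hc.aestronglyMeasurable.mul (Lp.aestronglyMeasurable _)) (Filter.Eventually.of_forall ?_)
  intro ξ
  have h1 : ‖evolutionSymbol t ξ‖ = 1 := by
    unfold evolutionSymbol
    rw [Complex.norm_exp]
    simp [-Complex.ofReal_sub, -Complex.ofReal_sum]
  simp [h1]

open Classical in
/-- The continuous representative of a kernel (the zero function if there is none).  It is unique,
and it exists as soon as the kernel is in the domain of `S^{(k,α)}` for some `α > 1/2`, because
the Fourier transform is then integrable. -/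
def continuousRep {k : ℕ} (γ : Kernel k) : EuclideanSpace ℝ (Fin k ⊕ Fin k) → ℂ :=
  if h : ∃ f : EuclideanSpace ℝ (Fin k ⊕ Fin k) → ℂ, Continuous f ∧ γ =ᵐ[volume] f then
    Classical.choose h
  else 0

/-- The point `(x₁,…,x_k,v,…,v; x'₁,…,x'_k,v,…,v)` with `p` copies of `v` on either side. -/
def insertPoint {k : ℕ} (p : ℕ) (v : ℝ) (z : EuclideanSpace ℝ (Fin k ⊕ Fin k)) :
    EuclideanSpace ℝ (Fin (k + p) ⊕ Fin (k + p)) :=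
  WithLp.toLp 2 (Sum.elim
    (Fin.append (fun i : Fin k => z (Sum.inl i)) (fun _ : Fin p => v))
    (Fin.append (fun i : Fin k => z (Sum.inr i)) (fun _ : Fin p => v)))

/-- Integration of a continuous kernel against
`δ(xⱼ-x_{k+1}) δ(xⱼ-x'_{k+1}) ⋯ δ(xⱼ-x_{k+p}) δ(xⱼ-x'_{k+p})` in the last `p` pairs of variables. -/
def contractPlus {k : ℕ} (p : ℕ) (j : Fin k)
    (f : EuclideanSpace ℝ (Fin (k + p) ⊕ Fin (k + p)) → ℂ) :
    EuclideanSpace ℝ (Fin k ⊕ Fin k) → ℂ :=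
  fun z => f (insertPoint p (z (Sum.inl j)) z)

/-- The same with `x'ⱼ` in place of `xⱼ`. -/
def contractMinus {k : ℕ} (p : ℕ) (j : Fin k)
    (f : EuclideanSpace ℝ (Fin (k + p) ⊕ Fin (k + p)) → ℂ) :
    EuclideanSpace ℝ (Fin k ⊕ Fin k) → ℂ :=
  fun z => f (insertPoint p (z (Sum.inr j)) z)

open Classical in
/-- The contraction operator `B_{j;k+1,…,k+p} = B⁺_{j;k+1,…,k+p} - B⁻_{j;k+1,…,k+p}`, taking
kernels of `k+p` particles to kernels of `k` particles (`0` if the result is not in `L²`, which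
does not happen on the domain of `S^{(k+p,α)}`, `α > 1/2`). -/
def B {k : ℕ} (p : ℕ) (j : Fin k) (γ : Kernel (k + p)) : Kernel k :=
  if h : MemLp (fun z => contractPlus p j (continuousRep γ) z
      - contractMinus p j (continuousRep γ) z) 2 volume then h.toLp _ else 0

/-- `Γ = (γ^{(k)})_{k ≥ 1}` solves on `[0,T]` the Gross–Pitaevskii hierarchy
`i∂ₜγ^{(k)} = ∑ⱼ (-Δ_{xⱼ} + Δ_{x'ⱼ}) γ^{(k)} + ∑_{p=1}^{p₀} b_p ∑ⱼ B_{j;k+1,…,k+p} γ^{(k+p)}`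
in one space dimension, in integral (Duhamel) form, with values in the domains of `S^{(k,α)}`.
The time integrals are Bochner integrals in `L²`. -/
structure IsSolution (p₀ : ℕ) (b : ℕ → ℝ) (α T : ℝ) (Γ : (k : ℕ) → ℝ → Kernel k) : Prop where
  inSobolev : ∀ k, 1 ≤ k → ∀ t ∈ Set.Icc 0 T, InSobolev α (Γ k t)
  integrable : ∀ k, 1 ≤ k → ∀ p ∈ Finset.Icc 1 p₀, ∀ j : Fin k, ∀ t ∈ Set.Icc 0 T,
    IntervalIntegrable (fun s => U (t - s) (B p j (Γ (k + p) s))) volume 0 t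
  duhamel : ∀ k, 1 ≤ k → ∀ t ∈ Set.Icc 0 T,
    Γ k t = U t (Γ k 0) - Complex.I • ∑ p ∈ Finset.Icc 1 p₀, (b p : ℂ) •
      ∑ j : Fin k, ∫ s in (0 : ℝ)..t, U (t - s) (B p j (Γ (k + p) s))

/-- The solution stays in the class of hierarchies with `‖S^{(k,α)} γ^{(k)}(t)‖ ≤ K^k`. -/
def SobolevGrowth (α T K : ℝ) (Γ : (k : ℕ) → ℝ → Kernel k) : Prop :=
  ∀ k, 1 ≤ k → ∀ t ∈ Set.Icc 0 T, InSobolev α (Γ k t) ∧ ‖S α (Γ k t)‖ ≤ K ^ k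

/-- `γ` is the kernel of a non-negative operator on `L²(ℝ^k)` with
`Tr (1-Δ_{x₁})⋯(1-Δ_{x_k}) γ ≤ E`: one has `γ = ∑ₙ |ψₙ⟩⟨ψₙ|`, with kernel
`∑ₙ ψₙ(x) conj ψₙ(x')`, and `∑ₙ ‖∏ⱼ (1-Δ_{xⱼ})^{1/2} ψₙ‖² ≤ E`. -/
def EnergyBound {k : ℕ} (E : ℝ) (γ : Kernel k) : Prop :=
  ∃ (ψ : ℕ → L2 (Fin k)) (g : ℕ → Kernel k),
    (∀ n, g n =ᵐ[volume] fun z =>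
      ψ n (WithLp.toLp 2 fun i => z (Sum.inl i)) *
        (starRingEnd ℂ) (ψ n (WithLp.toLp 2 fun i => z (Sum.inr i)))) ∧
    HasSum g γ ∧
    (∀ n, InSobolev 1 (ψ n)) ∧
    Summable (fun n => ‖S 1 (ψ n)‖ ^ 2) ∧
    ∑' n, ‖S 1 (ψ n)‖ ^ 2 ≤ E

/-- All `γ^{(k)}(t)` are non-negative with `Tr (1-Δ_{x₁})⋯(1-Δ_{x_k}) γ^{(k)}(t) ≤ K^k`. -/
def EnergyGrowth (T K : ℝ) (Γ : (k : ℕ) → ℝ → Kernel k) : Prop :=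
  ∀ k, 1 ≤ k → ∀ t ∈ Set.Icc 0 T, EnergyBound (K ^ k) (Γ k t)

end GPHierarchy

end

open GPHierarchy

open MeasureTheory FourierTransform

noncomputable section

namespace GPHierarchy

/-! ### The inverse Fourier transform on `L¹ ∩ L²`. -/

section InverseFourier

variable {E : Type*} [NormedAddCommGroup E] [InnerProductSpace ℝ E] [FiniteDimensional ℝ E]
  [MeasurableSpace E] [BorelSpace E]

/-! In one dimension with `α > 1/2`, the contractions `B` are bounded for the norms of `S^{(k,α)}`,
with a constant independent of `k`. The free evolution is an isometry for these norms, so the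
Duhamel series can be estimated term by term, with neither dispersive estimates nor a regrouping of
the terms.

The boundedness reduces to restriction to a hyperplane `x_a = x_b`. On the Fourier side this
integrates over all splittings of the frequency dual to `x_b` into a part `v` and a remainder.
Cauchy–Schwarz leaves the integral of `⟨ξ⟩^{2α} ⟨v⟩^{-2α} ⟨ξ-v⟩^{-2α}` over `v`, which is bounded
uniformly in `ξ` (`lintegral_bracket_ratio_le`, `energy_restrictDensity_le`). A contraction of `p`
pairs is `2p` such restrictions (`Rep.comp_surjective`), which gives `sobolevNorm_B_le`.

With zero initial data, `n` applications of the Duhamel formula bound the kernel of order `k` by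
`M^{k+nq}`, times `k(k+q)⋯(k+(n-1)q)` from the choices of `j`, times the volume `t^n/n!` of the time
simplex. The product over `n!` is at most `q^n 2^{k+n}` (`duhamelBound_le`), so the total is
geometric in `n` with ratio proportional to `T`. Letting `n → ∞` gives uniqueness for small `T`.

Two reductions remain. The difference of two solutions satisfies the Duhamel formula with zero data,
since `B` is linear on the Sobolev domain (`IsSolution.duhamel_sub`). The energy class lies in the
Sobolev class by the triangle inequality over rank-one kernels (`EnergyBound.sobolevNorm_le`). -/

theorem continuous_fourierInv_of_integrable {h : E → ℂ} (hh : Integrable h) :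
    Continuous (𝓕⁻ h : E → ℂ) := by
  refine VectorFourier.fourierIntegral_continuous (L := -innerₗ E) Real.continuous_fourierChar
    ?_ hh
  simp only [LinearMap.neg_apply, innerₗ_apply_apply]
  fun_prop

theorem integral_fourierInv_smul_comm {h g : E → ℂ} (hh : Integrable h) (hg : Integrable g) :
    ∫ x, (𝓕⁻ g : E → ℂ) x • h x = ∫ x, g x • (𝓕⁻ h : E → ℂ) x := by
  have hL : Continuous fun p : E × E => (-innerₗ E) p.1 p.2 := by
    simp only [LinearMap.neg_apply, innerₗ_apply_apply]
    fun_prop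
  have := VectorFourier.integral_fourierIntegral_smul_eq_flip (L := -innerₗ E) (μ := volume)
    (ν := volume) Real.continuous_fourierChar hL hg hh
  have e : (-innerₗ E : E →ₗ[ℝ] E →ₗ[ℝ] ℝ).flip = -innerₗ E := by
    ext x y
    simp [real_inner_comm]
  rw [e] at this
  exact this

/-- On `L¹ ∩ L²` the inverse Fourier transform of `L²` is given by the Fourier integral. -/
theorem fourierInv_toLp_ae {h : E → ℂ} (hh : Integrable h) (hh2 : MemLp h 2 volume) :
    (𝓕⁻ (hh2.toLp h) : Lp (α := E) ℂ 2 volume) =ᵐ[volume] (𝓕⁻ h : E → ℂ) := by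
  refine ae_eq_of_integral_contDiff_smul_eq ?_
    (continuous_fourierInv_of_integrable hh).locallyIntegrable ?_
  · exact (Lp.memLp _).locallyIntegrable (by norm_num)
  intro g hg hgs
  have hg' : ContDiff ℝ ((⊤ : ℕ∞) : WithTop ℕ∞) (fun x => (g x : ℂ)) :=
    Complex.ofRealCLM.contDiff.comp hg
  have hgs' : HasCompactSupport (fun x => (g x : ℂ)) :=
    hgs.comp_left (g := fun x : ℝ => (x : ℂ)) (by simp)
  set φ : SchwartzMap E ℂ := hgs'.toSchwartzMap hg' with hφ
  have hφx : ∀ x, φ x = g x := fun x => rfl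
  have h1 := congrArg (fun u => u φ) (Lp.fourierInv_toTemperedDistribution_eq (hh2.toLp h))
  simp only [TemperedDistribution.fourierInv_apply, Lp.toTemperedDistribution_apply] at h1
  calc ∫ x, g x • (𝓕⁻ (hh2.toLp h) : Lp (α := E) ℂ 2 volume) x
      = ∫ x, φ x • (𝓕⁻ (hh2.toLp h) : Lp (α := E) ℂ 2 volume) x := by
        simp only [hφx, Complex.real_smul, smul_eq_mul]
    _ = ∫ x, (𝓕⁻ φ : SchwartzMap E ℂ) x • (hh2.toLp h) x := h1.symm
    _ = ∫ x, (𝓕⁻ (φ : E → ℂ) : E → ℂ) x • h x := by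
        refine integral_congr_ae ?_
        filter_upwards [hh2.coeFn_toLp] with x hx
        rw [hx, SchwartzMap.fourierInv_coe]
    _ = ∫ x, φ x • (𝓕⁻ h : E → ℂ) x := integral_fourierInv_smul_comm hh φ.integrable
    _ = ∫ x, g x • (𝓕⁻ h : E → ℂ) x := by
        simp only [hφx, Complex.real_smul, smul_eq_mul]

end InverseFourier

/-! ### Sobolev weights and the uniform convolution estimate. -/

section Weights

/-- The squared Japanese bracket `⟨2πx⟩^{2α}`. -/
def bracket (α x : ℝ) : ENNReal := ENNReal.ofReal ((1 + (2 * Real.pi * x) ^ 2) ^ α)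

/-- The square of the symbol of `∏ᵢ (1 - ∂ᵢ²)^{α/2}`. -/
def weight {ι : Type} [Fintype ι] (α : ℝ) (η : ι → ℝ) : ENNReal := ∏ i, bracket α (η i)

theorem measurable_bracket (α : ℝ) : Measurable (bracket α) := by
  unfold bracket
  fun_prop

theorem bracket_ne_top (α x : ℝ) : bracket α x ≠ ⊤ := ENNReal.ofReal_ne_top

theorem one_le_bracket {α : ℝ} (hα : 0 ≤ α) (x : ℝ) : 1 ≤ bracket α x := by
  rw [bracket, ENNReal.one_le_ofReal]
  exact Real.one_le_rpow (by nlinarith [sq_nonneg (2 * Real.pi * x)]) hα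

theorem bracket_ne_zero (α x : ℝ) : bracket α x ≠ 0 := by
  rw [bracket, Ne, ENNReal.ofReal_eq_zero, not_le]
  positivity

theorem bracket_neg (α x : ℝ) : bracket α (-x) = bracket α x := by
  simp [bracket]

theorem bracket_mono {α β : ℝ} (h : α ≤ β) (x : ℝ) : bracket α x ≤ bracket β x :=
  ENNReal.ofReal_le_ofReal
    (Real.rpow_le_rpow_of_exponent_le (by nlinarith [sq_nonneg (2 * Real.pi * x)]) h)

/-- Combines `(x+y)² ≤ 2x² + 2y²` with subadditivity of `s ↦ s^α`. The hypothesis `α ≤ 1` enters the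
contraction estimate here. -/
theorem bracket_add_le {α : ℝ} (h0 : 0 ≤ α) (h1 : α ≤ 1) (x y : ℝ) :
    bracket α (x + y) ≤ 2 * (bracket α x + bracket α y) := by
  unfold bracket
  rw [← ENNReal.ofReal_add (by positivity) (by positivity),
    ← ENNReal.ofReal_ofNat 2, ← ENNReal.ofReal_mul (by norm_num)]
  refine ENNReal.ofReal_le_ofReal ?_
  set a := 1 + (2 * Real.pi * x) ^ 2 with ha
  set b := 1 + (2 * Real.pi * y) ^ 2 with hb
  have ha0 : 0 ≤ a := by positivity
  have hb0 : 0 ≤ b := by positivity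
  calc (1 + (2 * Real.pi * (x + y)) ^ 2) ^ α ≤ (2 * (a + b)) ^ α := by
        refine Real.rpow_le_rpow (by positivity) ?_ h0
        nlinarith [sq_nonneg (2 * Real.pi * x - 2 * Real.pi * y)]
    _ = 2 ^ α * (a + b) ^ α := Real.mul_rpow (by norm_num) (by positivity)
    _ ≤ 2 * (a ^ α + b ^ α) := by
        refine mul_le_mul ?_ (Real.rpow_add_le_add_rpow ha0 hb0 h0 h1) (by positivity)
          (by norm_num)
        calc (2 : ℝ) ^ α ≤ 2 ^ (1 : ℝ) := Real.rpow_le_rpow_of_exponent_le (by norm_num) h1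
          _ = 2 := Real.rpow_one 2

theorem integrable_bracket_inv {α : ℝ} (hα : 1 / 2 < α) :
    Integrable fun x : ℝ => ((1 + (2 * Real.pi * x) ^ 2) ^ α)⁻¹ := by
  have h := integrable_rpow_neg_one_add_norm_sq (E := ℝ) (μ := volume) (r := 2 * α)
    (by simp only [Module.finrank_self, Nat.cast_one]; linarith)
  have h2 := h.comp_mul_left' (R := 2 * Real.pi) (by positivity)
  refine h2.congr (Filter.Eventually.of_forall fun x => ?_)
  simp only [Real.norm_eq_abs, sq_abs]
  rw [show -(2 * α) / 2 = -α by ring, Real.rpow_neg (by positivity)]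

/-- The integral of `⟨2πx⟩^{-2α}`. -/
def bracketMass (α : ℝ) : ENNReal := ∫⁻ x, (bracket α x)⁻¹

theorem bracket_inv_eq (α x : ℝ) :
    (bracket α x)⁻¹ = ENNReal.ofReal ((1 + (2 * Real.pi * x) ^ 2) ^ α)⁻¹ := by
  rw [bracket, ENNReal.ofReal_inv_of_pos (by positivity)]

theorem bracketMass_ne_top {α : ℝ} (hα : 1 / 2 < α) : bracketMass α ≠ ⊤ := by
  have := (integrable_bracket_inv hα).lintegral_lt_top
  simp_rw [bracketMass, bracket_inv_eq]
  exact this.ne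

/-- Since `x = y + (x - y)`, the numerator is controlled by the two denominators. Each summand
cancels one of them and leaves a reflected translate of, or exactly, the function integrated in
`bracketMass`. Uniformity in `x` is what makes restriction to a hyperplane bounded. -/
theorem lintegral_bracket_ratio_le {α : ℝ} (h0 : 0 ≤ α) (h1 : α ≤ 1) (x : ℝ) :
    ∫⁻ y, bracket α x * ((bracket α y)⁻¹ * (bracket α (x - y))⁻¹) ≤ 4 * bracketMass α := by
  have hm := measurable_bracket α
  calc ∫⁻ y, bracket α x * ((bracket α y)⁻¹ * (bracket α (x - y))⁻¹)
      ≤ ∫⁻ y, (2 * (bracket α (x - y))⁻¹ + 2 * (bracket α y)⁻¹) := by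
        refine lintegral_mono fun y => ?_
        have hb := bracket_add_le h0 h1 y (x - y)
        rw [add_sub_cancel] at hb
        refine (mul_le_mul_left hb _).trans (le_of_eq ?_)
        have e1 := ENNReal.mul_inv_cancel (bracket_ne_zero α y) (bracket_ne_top α y)
        have e2 := ENNReal.mul_inv_cancel (bracket_ne_zero α (x - y)) (bracket_ne_top α (x - y))
        calc 2 * (bracket α y + bracket α (x - y)) * ((bracket α y)⁻¹ * (bracket α (x - y))⁻¹)
            = 2 * ((bracket α y * (bracket α y)⁻¹) * (bracket α (x - y))⁻¹)
              + 2 * ((bracket α (x - y) * (bracket α (x - y))⁻¹) * (bracket α y)⁻¹) := by ring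
          _ = _ := by rw [e1, e2, one_mul, one_mul]
    _ = 2 * bracketMass α + 2 * bracketMass α := by
        rw [lintegral_add_left (by fun_prop), lintegral_const_mul _ (by fun_prop),
          lintegral_const_mul _ (by fun_prop),
          lintegral_sub_left_eq_self (fun y => (bracket α y)⁻¹) x, bracketMass]
    _ = 4 * bracketMass α := by ring

variable {ι : Type} [Fintype ι]

theorem measurable_weight (α : ℝ) : Measurable (weight (ι := ι) α) := by
  unfold weight
  exact Finset.measurable_prod _ fun i _ => (measurable_bracket α).comp (measurable_pi_apply i)

theorem weight_ne_top (α : ℝ) (η : ι → ℝ) : weight α η ≠ ⊤ :=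
  ENNReal.prod_ne_top fun _ _ => bracket_ne_top _ _

theorem weight_ne_zero (α : ℝ) (η : ι → ℝ) : weight α η ≠ 0 :=
  Finset.prod_ne_zero_iff.2 fun _ _ => bracket_ne_zero _ _

theorem one_le_weight {α : ℝ} (hα : 0 ≤ α) (η : ι → ℝ) : 1 ≤ weight α η :=
  Finset.one_le_prod' fun _ _ => one_le_bracket hα _

theorem weight_mono {α β : ℝ} (h : α ≤ β) (η : ι → ℝ) : weight α η ≤ weight β η :=
  Finset.prod_le_prod' fun _ _ => bracket_mono h _

theorem lintegral_weight_inv_ne_top {α : ℝ} (hα : 1 / 2 < α) :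
    ∫⁻ η : ι → ℝ, (weight α η)⁻¹ ≠ ⊤ := by
  have := (Integrable.fintype_prod (ι := ι) (μ := fun _ => (volume : Measure ℝ))
    (fun _ => integrable_bracket_inv hα)).lintegral_lt_top
  refine ne_of_eq_of_ne (lintegral_congr fun η => ?_) this.ne
  rw [weight, ENNReal.ofReal_prod_of_nonneg (fun _ _ => by positivity),
    ENNReal.prod_inv_distrib (fun _ _ _ _ _ => Or.inl (bracket_ne_zero _ _))]
  exact Finset.prod_congr rfl fun i _ => bracket_inv_eq _ _

end Weights

theorem sq_lintegral_mul_le {X : Type*} [MeasurableSpace X] {μ : Measure X} {f g : X → ENNReal}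
    (hf : AEMeasurable f μ) (hg : AEMeasurable g μ) :
    (∫⁻ x, f x * g x ∂μ) ^ 2 ≤ (∫⁻ x, f x ^ 2 ∂μ) * ∫⁻ x, g x ^ 2 ∂μ := by
  have h := ENNReal.lintegral_mul_le_Lp_mul_Lq μ Real.HolderConjugate.two_two hf hg
  simp only [Pi.mul_apply, ENNReal.rpow_two] at h
  refine (pow_le_pow_left₀ zero_le h 2).trans (le_of_eq ?_)
  rw [mul_pow, ← ENNReal.rpow_two, ← ENNReal.rpow_two, ← ENNReal.rpow_mul, ← ENNReal.rpow_mul]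
  norm_num

theorem integral_comp_of_measurePreserving {X Y : Type*} [MeasurableSpace X] [MeasurableSpace Y]
    {μ : Measure X} {ν : Measure Y} {g : X → Y} (hg : MeasurePreserving g μ ν) {f : Y → ℂ}
    (hf : AEStronglyMeasurable f ν) : ∫ x, f (g x) ∂μ = ∫ y, f y ∂ν := by
  rw [← hg.map_eq] at hf ⊢
  exact (integral_map hg.measurable.aemeasurable hf).symm

/-! ### Functions given pointwise by a spectral density of finite energy. -/

section Rep

variable {ι κ : Type} [Fintype ι] [Fintype κ]

/-- The character `e^{2πi x·η}`. -/
def phase (x η : ι → ℝ) : ℂ := (Real.fourierChar (∑ i, x i * η i) : ℂ)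

theorem norm_phase (x η : ι → ℝ) : ‖phase x η‖ = 1 := Circle.norm_coe _

theorem measurable_phase (x : ι → ℝ) : Measurable (phase x) := by
  unfold phase
  have : Continuous fun η : ι → ℝ => (Real.fourierChar (∑ i, x i * η i) : ℂ) := by fun_prop
  exact this.measurable

/-- The squared weighted norm `∫ ∏ᵢ ⟨2πηᵢ⟩^{2α} |h(η)|² dη`. -/
def energy (α : ℝ) (h : (ι → ℝ) → ℂ) : ENNReal := ∫⁻ η, weight α η * ‖h η‖ₑ ^ 2

/-- `f(x) = ∫ e^{2πi x·η} h(η) dη` with a spectral density `h` of finite energy. -/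
structure Rep (α : ℝ) (h f : (ι → ℝ) → ℂ) : Prop where
  measurable : Measurable h
  energy_ne_top : energy α h ≠ ⊤
  eq : ∀ x, f x = ∫ η, phase x η * h η

theorem lintegral_enorm_sq_le_energy {α : ℝ} (hα : 0 ≤ α) (h : (ι → ℝ) → ℂ) :
    ∫⁻ η, ‖h η‖ₑ ^ 2 ≤ energy α h :=
  lintegral_mono fun η => le_mul_of_one_le_left zero_le (one_le_weight hα η)

/-- Cauchy–Schwarz for the splitting `|h| = w^{-1/2} · w^{1/2}|h|`; the inverse weight is integrable
because `α > 1/2`. -/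
theorem integrable_of_energy {α : ℝ} (hα : 1 / 2 < α) {h : (ι → ℝ) → ℂ} (hm : Measurable h)
    (he : energy α h ≠ ⊤) : Integrable h := by
  refine ⟨hm.aestronglyMeasurable, ?_⟩
  have hw := measurable_weight (ι := ι) α
  have key : (∫⁻ η, ‖h η‖ₑ) ^ 2 ≤ (∫⁻ η : ι → ℝ, (weight α η)⁻¹) * energy α h := by
    have := sq_lintegral_mul_le (μ := (volume : Measure (ι → ℝ)))
      (f := fun η => ((weight α η)⁻¹) ^ (1 / 2 : ℝ))
      (g := fun η => (weight α η) ^ (1 / 2 : ℝ) * ‖h η‖ₑ) (by fun_prop) (by fun_prop)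
    have hsq : ∀ y : ENNReal, (y ^ (1 / 2 : ℝ)) ^ 2 = y := fun y => by
      rw [← ENNReal.rpow_two, ← ENNReal.rpow_mul]; norm_num
    simp only [mul_pow, hsq] at this
    refine le_of_eq_of_le ?_ this
    congr 2 with η
    rw [← mul_assoc, ← ENNReal.mul_rpow_of_nonneg _ _ (by norm_num),
      ENNReal.inv_mul_cancel (weight_ne_zero α η) (weight_ne_top α η), ENNReal.one_rpow, one_mul]
  have hlt : (∫⁻ η, ‖h η‖ₑ) ^ 2 < ⊤ :=
    key.trans_lt (ENNReal.mul_lt_top (lintegral_weight_inv_ne_top hα).lt_top he.lt_top)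
  exact (ENNReal.pow_lt_top_iff.1 hlt).resolve_right two_ne_zero

theorem Rep.integrable {α : ℝ} (hα : 1 / 2 < α) {h f : (ι → ℝ) → ℂ} (H : Rep α h f) :
    Integrable h := integrable_of_energy hα H.measurable H.energy_ne_top

theorem integrable_phase_mul {h : (ι → ℝ) → ℂ} (hh : Integrable h) (x : ι → ℝ) :
    Integrable fun η => phase x η * h η :=
  hh.bdd_mul (c := 1) (measurable_phase x).aestronglyMeasurable
    (Filter.Eventually.of_forall fun η => (norm_phase x η).le)

theorem energy_sub_le (α : ℝ) {h h' : (ι → ℝ) → ℂ} (hm : Measurable h) :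
    energy α (h - h') ≤ 2 * (energy α h + energy α h') := by
  have hw := measurable_weight (ι := ι) α
  unfold energy
  rw [← lintegral_add_left (by fun_prop), ← lintegral_const_mul' _ _ (by norm_num)]
  refine lintegral_mono fun η => ?_
  rw [← mul_add, mul_left_comm]
  refine mul_le_mul_right ?_ _
  calc ‖(h - h') η‖ₑ ^ 2 ≤ (‖h η‖ₑ + ‖h' η‖ₑ) ^ 2 := by
        gcongr
        exact enorm_sub_le
    _ ≤ 2 * (‖h η‖ₑ ^ 2 + ‖h' η‖ₑ ^ 2) := by
        rw [enorm_eq_nnnorm, enorm_eq_nnnorm]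
        exact_mod_cast add_sq_le (a := ‖h η‖₊) (b := ‖h' η‖₊)

theorem Rep.sub {α : ℝ} (hα : 1 / 2 < α) {h f h' f' : (ι → ℝ) → ℂ} (H : Rep α h f)
    (H' : Rep α h' f') : Rep α (h - h') (f - f') where
  measurable := H.measurable.sub H'.measurable
  energy_ne_top := ne_top_of_le_ne_top
    (ENNReal.mul_ne_top (by norm_num) (ENNReal.add_ne_top.2 ⟨H.energy_ne_top, H'.energy_ne_top⟩))
    (energy_sub_le α H.measurable)
  eq x := by
    rw [Pi.sub_apply, H.eq, H'.eq, ← integral_sub (integrable_phase_mul (H.integrable hα) x)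
      (integrable_phase_mul (H'.integrable hα) x)]
    simp [mul_sub]

theorem measurePreserving_reindex (e : κ ≃ ι) :
    MeasurePreserving (fun ξ : ι → ℝ => ξ ∘ e) volume volume := by
  have := volume_measurePreserving_piCongrLeft (fun _ : κ => ℝ) e.symm
  convert! this using 1
  ext ξ i
  have := MeasurableEquiv.piCongrLeft_apply_apply e.symm (β := fun _ => ℝ) ξ (e i)
  simpa using this.symm

theorem Rep.reindex {α : ℝ} {h f : (κ → ℝ) → ℂ} (H : Rep α h f) (e : κ ≃ ι) :
    Rep α (fun ξ : ι → ℝ => h (ξ ∘ e)) (fun x => f (x ∘ e)) ∧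
      energy α (fun ξ : ι → ℝ => h (ξ ∘ e)) = energy α h := by
  have hmp := measurePreserving_reindex e
  have hw := measurable_weight (ι := κ) α
  have hm := H.measurable
  have hE : energy α (fun ξ : ι → ℝ => h (ξ ∘ e)) = energy α h := by
    rw [energy, energy, ← hmp.lintegral_comp (by fun_prop)]
    refine lintegral_congr fun ξ => ?_
    congr 1
    exact (Equiv.prod_comp e fun i => bracket α (ξ i)).symm
  refine ⟨⟨hm.comp hmp.measurable, hE ▸ H.energy_ne_top, fun x => ?_⟩, hE⟩
  rw [H.eq, ← integral_comp_of_measurePreserving hmp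
    (f := fun η => phase (x ∘ e) η * h η) ((measurable_phase _).mul hm).aestronglyMeasurable]
  refine integral_congr_ae (Filter.Eventually.of_forall fun ξ => ?_)
  simp only [phase]
  congr 3
  exact Equiv.sum_comp e fun i => x i * ξ i

end Rep

/-! ### Restriction to a hyperplane `x_a = x_b`. -/

section Diagonal

variable {κ : Type} [DecidableEq κ]

/-- The point with coordinate `v` at `a` and the remaining coordinates given by `ξ`. -/
def insertAt (a : κ) (v : ℝ) (ξ : {i // i ≠ a} → ℝ) : κ → ℝ :=
  fun i => if h : i = a then v else ξ ⟨i, h⟩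

@[simp]
theorem insertAt_self (a : κ) (v : ℝ) (ξ : {i // i ≠ a} → ℝ) : insertAt a v ξ a = v := by
  simp [insertAt]

@[simp]
theorem insertAt_coe (a : κ) (v : ℝ) (ξ : {i // i ≠ a} → ℝ) (i : {i // i ≠ a}) :
    insertAt a v ξ i = ξ i := by
  simp [insertAt, i.2]

/-- The retraction of `κ` onto `κ \ {a}` that sends `a` to `b`. -/
def mergeInto (a : κ) (b : {i // i ≠ a}) : κ → {i // i ≠ a} :=
  fun i => if h : i = a then b else ⟨i, h⟩

@[simp]
theorem mergeInto_self (a : κ) (b : {i // i ≠ a}) : mergeInto a b a = b := by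
  simp [mergeInto]

@[simp]
theorem mergeInto_coe (a : κ) (b i : {i // i ≠ a}) : mergeInto a b i = i := by
  simp [mergeInto, i.2]

variable [Fintype κ]

theorem measurePreserving_insertAt (a : κ) :
    MeasurePreserving (fun p : ℝ × ({i // i ≠ a} → ℝ) => insertAt a p.1 p.2)
      (volume.prod volume) volume := by
  have h1 : MeasurePreserving
      (MeasurableEquiv.piEquivPiSubtypeProd (fun _ : κ => ℝ) (fun i => i = a)).symm
      (volume : Measure (({i // i = a} → ℝ) × ({i // ¬ i = a} → ℝ))) volume := by
    convert! (volume_preserving_piEquivPiSubtypeProd (fun _ : κ => ℝ) (fun i => i = a)).symm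
  have h2 : MeasurePreserving (MeasurableEquiv.funUnique {i // i = a} ℝ).symm volume volume := by
    convert! (volume_preserving_funUnique {i // i = a} ℝ).symm
  have h3 : MeasurePreserving (Prod.map (MeasurableEquiv.funUnique {i // i = a} ℝ).symm id)
      (volume.prod volume) (volume : Measure (({i // i = a} → ℝ) × ({i // ¬ i = a} → ℝ))) :=
    h2.prod (MeasurePreserving.id volume)
  exact h1.comp h3

/-- The shear `(v, ξ) ↦ (v, ξ - v e_b)` followed by insertion of `v` at `a`. -/
def shearInsert (a : κ) (b : {i // i ≠ a}) (p : ℝ × ({i // i ≠ a} → ℝ)) : κ → ℝ :=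
  insertAt a p.1 (p.2 - Pi.single b p.1)

/-- For fixed `v` the shear is a translation in `ξ`, so it preserves the product measure. -/
theorem measurePreserving_shearInsert (a : κ) (b : {i // i ≠ a}) :
    MeasurePreserving (shearInsert a b) (volume.prod volume) volume := by
  have h : MeasurePreserving
      (fun p : ℝ × ({i // i ≠ a} → ℝ) => (p.1, p.2 - Pi.single b p.1))
      (volume.prod volume) (volume.prod volume) := by
    refine (MeasurePreserving.id volume).skew_product
      (g := fun (v : ℝ) (ξ : {i // i ≠ a} → ℝ) => ξ - Pi.single b v) ?_
      (Filter.Eventually.of_forall fun v => (measurePreserving_sub_right volume _).map_eq)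
    have : Continuous fun p : ℝ × ({i // i ≠ a} → ℝ) =>
        p.2 - (Pi.single b p.1 : {i // i ≠ a} → ℝ) :=
      continuous_snd.sub ((continuous_single b).comp continuous_fst)
    exact this.measurable
  exact (measurePreserving_insertAt a).comp h

/-- On the hyperplane `x_a = x_b` the phase sees only the sum of the frequencies at `a` and `b`, and
the shear makes that sum equal to `ξ_b`, whatever `v` is. -/
theorem phase_mergeInto (a : κ) (b : {i // i ≠ a}) (x : {i // i ≠ a} → ℝ)
    (p : ℝ × ({i // i ≠ a} → ℝ)) :
    phase (x ∘ mergeInto a b) (shearInsert a b p) = phase x p.2 := by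
  unfold phase
  congr 2
  rw [Fintype.sum_eq_add_sum_subtype_ne _ a]
  simp only [Function.comp_apply, mergeInto_self, mergeInto_coe, shearInsert, insertAt_self,
    insertAt_coe, Pi.sub_apply, mul_sub, Finset.sum_sub_distrib]
  rw [Finset.sum_eq_single (f := fun i => x i * (Pi.single b p.1 : {i // i ≠ a} → ℝ) i) b
    (fun i _ hi => by simp [hi]) (by simp), Pi.single_eq_same]
  ring

theorem weight_shearInsert (α : ℝ) (a : κ) (b : {i // i ≠ a})
    (p : ℝ × ({i // i ≠ a} → ℝ)) :
    weight α (shearInsert a b p) * bracket α (p.2 b) =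
      weight α p.2 * (bracket α p.1 * bracket α (p.2 b - p.1)) := by
  unfold weight
  rw [Fintype.prod_eq_mul_prod_subtype_ne _ a, Fintype.prod_eq_mul_prod_subtype_ne
    (fun i : {i // i ≠ a} => bracket α (shearInsert a b p i)) b,
    Fintype.prod_eq_mul_prod_subtype_ne (fun i : {i // i ≠ a} => bracket α (p.2 i)) b]
  have : ∀ i : {i // i ≠ b}, bracket α (shearInsert a b p i) = bracket α (p.2 i) := fun i => by
    simp [shearInsert, i.2]
  simp only [this]
  simp only [shearInsert, insertAt_self, insertAt_coe, Pi.sub_apply, Pi.single_eq_same]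
  ring

/-- Only the factors at `a` and `b` differ between the two weights. Their quotient is the integrand
of `lintegral_bracket_ratio_le`. -/
theorem weight_eq_ratio (α : ℝ) (a : κ) (b : {i // i ≠ a}) (p : ℝ × ({i // i ≠ a} → ℝ)) :
    weight α p.2 = (bracket α (p.2 b) * ((bracket α p.1)⁻¹ * (bracket α (p.2 b - p.1))⁻¹)) *
      weight α (shearInsert a b p) := by
  have h := weight_shearInsert α a b p
  have e1 := ENNReal.mul_inv_cancel (bracket_ne_zero α p.1) (bracket_ne_top α p.1)
  have e2 := ENNReal.mul_inv_cancel (bracket_ne_zero α (p.2 b - p.1))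
    (bracket_ne_top α (p.2 b - p.1))
  calc weight α p.2 = weight α p.2 * (bracket α p.1 * (bracket α p.1)⁻¹) *
        (bracket α (p.2 b - p.1) * (bracket α (p.2 b - p.1))⁻¹) := by
        rw [e1, e2, mul_one, mul_one]
    _ = (weight α p.2 * (bracket α p.1 * bracket α (p.2 b - p.1))) *
        ((bracket α p.1)⁻¹ * (bracket α (p.2 b - p.1))⁻¹) := by ring
    _ = _ := by rw [← h]; ring

/-- The spectral density of the restriction of a function to the hyperplane `x_a = x_b`. -/
def restrictDensity (a : κ) (b : {i // i ≠ a}) (h : (κ → ℝ) → ℂ) (ξ : {i // i ≠ a} → ℝ) : ℂ :=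
  ∫ v, h (shearInsert a b (v, ξ))

/-- The trace estimate: Cauchy–Schwarz in `v` on each fibre, then integration over `ξ` and undoing
the measure-preserving shear. -/
theorem energy_restrictDensity_le {α : ℝ} (h0 : 0 ≤ α) (h1 : α ≤ 1) (a : κ)
    (b : {i // i ≠ a}) {h : (κ → ℝ) → ℂ} (hm : Measurable h) :
    energy α (restrictDensity a b h) ≤ 4 * bracketMass α * energy α h := by
  have hmp := measurePreserving_shearInsert a b
  have hT := hmp.measurable
  have hw := measurable_weight (ι := κ) α
  have hb := measurable_bracket α
  have hsq : ∀ y : ENNReal, (y ^ (1 / 2 : ℝ)) ^ 2 = y := fun y => by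
    rw [← ENNReal.rpow_two, ← ENNReal.rpow_mul]; norm_num
  have key : ∀ ξ : {i // i ≠ a} → ℝ, weight α ξ * ‖restrictDensity a b h ξ‖ₑ ^ 2 ≤
      4 * bracketMass α * ∫⁻ v, weight α (shearInsert a b (v, ξ)) *
        ‖h (shearInsert a b (v, ξ))‖ₑ ^ 2 := by
    intro ξ
    have hTξ : Measurable fun v => shearInsert a b (v, ξ) := hT.comp measurable_prodMk_right
    -- The square root of the weight at `ξ` is factored into the roots of the ratio and of the
    -- weight at the sheared point; the `v`-integral of the ratio is bounded uniformly in `ξ`.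
    have cs := sq_lintegral_mul_le (μ := (volume : Measure ℝ))
      (f := fun v => (bracket α (ξ b) * ((bracket α v)⁻¹ * (bracket α (ξ b - v))⁻¹)) ^ (1 / 2 : ℝ))
      (g := fun v => (weight α (shearInsert a b (v, ξ))) ^ (1 / 2 : ℝ) *
        ‖h (shearInsert a b (v, ξ))‖ₑ) (by fun_prop) (by fun_prop)
    simp only [mul_pow, hsq] at cs
    refine le_trans ?_ (cs.trans (mul_le_mul_left (lintegral_bracket_ratio_le h0 h1 (ξ b)) _))
    rw [← hsq (weight α ξ), ← mul_pow]
    gcongr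
    calc weight α ξ ^ (1 / 2 : ℝ) * ‖restrictDensity a b h ξ‖ₑ
        ≤ weight α ξ ^ (1 / 2 : ℝ) * ∫⁻ v, ‖h (shearInsert a b (v, ξ))‖ₑ := by
          gcongr
          exact enorm_integral_le_lintegral_enorm _
      _ = ∫⁻ v, weight α ξ ^ (1 / 2 : ℝ) * ‖h (shearInsert a b (v, ξ))‖ₑ :=
          (lintegral_const_mul _ (by fun_prop)).symm
      _ ≤ _ := by
          refine lintegral_mono fun v => le_of_eq ?_
          rw [← mul_assoc, ← ENNReal.mul_rpow_of_nonneg _ _ (by norm_num),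
            weight_eq_ratio α a b (v, ξ)]
  calc energy α (restrictDensity a b h)
      ≤ ∫⁻ ξ, 4 * bracketMass α * ∫⁻ v, weight α (shearInsert a b (v, ξ)) *
        ‖h (shearInsert a b (v, ξ))‖ₑ ^ 2 := lintegral_mono key
    _ = 4 * bracketMass α * ∫⁻ ξ, ∫⁻ v, weight α (shearInsert a b (v, ξ)) *
        ‖h (shearInsert a b (v, ξ))‖ₑ ^ 2 := by
        refine lintegral_const_mul _ ?_
        exact Measurable.lintegral_prod_left' (f := fun p : ℝ × ({i // i ≠ a} → ℝ) =>
          weight α (shearInsert a b p) * ‖h (shearInsert a b p)‖ₑ ^ 2) (by fun_prop)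
    _ = 4 * bracketMass α * energy α h := by
        congr 1
        rw [energy, ← hmp.lintegral_comp (by fun_prop), lintegral_prod_symm _ (by fun_prop)]

theorem Rep.restrict {α : ℝ} (hα : 1 / 2 < α) (h1 : α ≤ 1) (a : κ)
    (b : {i // i ≠ a}) {h f : (κ → ℝ) → ℂ} (H : Rep α h f) :
    Rep α (restrictDensity a b h) (fun x => f (x ∘ mergeInto a b)) where
  measurable :=
    (StronglyMeasurable.integral_prod_left' (f := fun p => h (shearInsert a b p))
      (H.measurable.comp (measurePreserving_shearInsert a b).measurable).stronglyMeasurable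
      ).measurable
  energy_ne_top := ne_top_of_le_ne_top
    (ENNReal.mul_ne_top (ENNReal.mul_ne_top (by norm_num) (bracketMass_ne_top hα))
      H.energy_ne_top)
    (energy_restrictDensity_le (by linarith) h1 a b H.measurable)
  eq x := by
    have hmp := measurePreserving_shearInsert a b
    have hi := integrable_phase_mul (H.integrable hα) (x ∘ mergeInto a b)
    have hi2 := (hmp.integrable_comp hi.aestronglyMeasurable).2 hi
    rw [H.eq, ← integral_comp_of_measurePreserving hmp hi.aestronglyMeasurable,
      ← Function.comp_def (fun η => phase (x ∘ mergeInto a b) η * h η), integral_prod_symm _ hi2]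
    refine integral_congr_ae (Filter.Eventually.of_forall fun ξ => ?_)
    simp only [Function.comp_apply, phase_mergeInto, restrictDensity]
    exact integral_const_mul _ _

/-- The constant of the restriction to a hyperplane `x_a = x_b`. -/
def restrictConst (α : ℝ) : ENNReal := 4 * bracketMass α

end Diagonal

/-- Iterates the trace estimate. As long as `φ` is not injective it identifies two indices `a`, `b`,
hence factors through the restriction to `x_a = x_b`, which removes one coordinate and costs one
factor `restrictConst α`. -/
theorem Rep.comp_surjective {α : ℝ} (hα : 1 / 2 < α) (h1 : α ≤ 1) (n : ℕ) :
    ∀ {κ ι : Type} [Fintype κ] [Fintype ι] (φ : κ → ι), Function.Surjective φ →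
      Fintype.card κ = Fintype.card ι + n → ∀ {h f : (κ → ℝ) → ℂ}, Rep α h f →
      ∃ h' : (ι → ℝ) → ℂ, Rep α h' (fun x => f (x ∘ φ)) ∧
        energy α h' ≤ restrictConst α ^ n * energy α h := by
  induction n with
  | zero =>
    intro κ ι _ _ φ hφ hc h f H
    have hb : Function.Bijective φ :=
      (Fintype.bijective_iff_surjective_and_card φ).2 ⟨hφ, by simpa using hc⟩
    obtain ⟨H1, H2⟩ := H.reindex (Equiv.ofBijective φ hb)
    exact ⟨_, H1, by rw [pow_zero, one_mul, H2]⟩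
  | succ n ih =>
    intro κ ι _ _ φ hφ hc h f H
    classical
    have hni : ¬ Function.Injective φ := fun hi => by
      have := Fintype.card_le_of_injective φ hi
      omega
    obtain ⟨a, b, hab, hne⟩ : ∃ a b, φ a = φ b ∧ a ≠ b := by
      simpa [Function.Injective] using hni
    let b' : {i // i ≠ a} := ⟨b, hne.symm⟩
    let ψ : {i // i ≠ a} → ι := fun i => φ i
    have hψφ : ψ ∘ mergeInto a b' = φ := by
      ext i
      by_cases hi : i = a
      · subst hi
        simp [ψ, b', hab]
      · simp [ψ, mergeInto, hi]
    have hψ : Function.Surjective ψ := Function.Surjective.of_comp (hψφ ▸ hφ)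
    have hcard : Fintype.card {i // i ≠ a} = Fintype.card ι + n := by
      have := Fintype.card_subtype_compl (fun i => i = a)
      simp only [Fintype.card_subtype_eq] at this
      have e : Fintype.card {i // i ≠ a} = Fintype.card {i // ¬ i = a} := rfl
      omega
    obtain ⟨h', H1, H2⟩ := ih ψ hψ hcard (H.restrict hα h1 a b')
    refine ⟨h', ?_, ?_⟩
    · have : (fun x : ι → ℝ => f ((x ∘ ψ) ∘ mergeInto a b')) = fun x => f (x ∘ φ) := by
        ext x
        rw [Function.comp_assoc, hψφ]
      exact this ▸ H1
    · calc energy α h' ≤ restrictConst α ^ n * energy α (restrictDensity a b' h) := H2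
        _ ≤ restrictConst α ^ n * (restrictConst α * energy α h) := by
          gcongr
          exact energy_restrictDensity_le (by linarith) h1 a b' H.measurable
        _ = restrictConst α ^ (n + 1) * energy α h := by ring

/-! ### Rank-one kernels. -/

section Tensor

variable {ι : Type} [Fintype ι]

/-- The spectral density of `f(x) conj f(x')`. -/
def tensorDensity (h : (ι → ℝ) → ℂ) (η : ι ⊕ ι → ℝ) : ℂ :=
  h (η ∘ Sum.inl) * (starRingEnd ℂ) (h (-(η ∘ Sum.inr)))

/-- The sign on the primed frequencies is there because conjugating a function reflects its
frequencies. -/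
theorem measurePreserving_sumSplit :
    MeasurePreserving (fun η : ι ⊕ ι → ℝ => (η ∘ Sum.inl, -(η ∘ Sum.inr))) volume
      (volume.prod volume) := by
  have h := volume_measurePreserving_sumPiEquivProdPi (fun _ : ι ⊕ ι => ℝ)
  exact ((MeasurePreserving.id volume).prod (Measure.measurePreserving_neg volume)).comp h

theorem energy_tensorDensity (α : ℝ) {h : (ι → ℝ) → ℂ} (hm : Measurable h) :
    energy α (tensorDensity h) = energy α h ^ 2 := by
  have hw := measurable_weight (ι := ι) α
  have hmul := lintegral_prod_mul (μ := (volume : Measure (ι → ℝ)))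
    (ν := (volume : Measure (ι → ℝ))) (f := fun η => weight α η * ‖h η‖ₑ ^ 2)
    (g := fun η => weight α η * ‖h η‖ₑ ^ 2) (by fun_prop) (by fun_prop)
  rw [energy, sq, energy, ← hmul, ← measurePreserving_sumSplit.lintegral_comp (by fun_prop)]
  refine lintegral_congr fun η => ?_
  have hw2 : weight α η = weight α (η ∘ Sum.inl) * weight α (-(η ∘ Sum.inr)) := by
    simp [weight, Fintype.prod_sum_type, bracket_neg]
  simp only [hw2, tensorDensity, enorm_mul, RCLike.enorm_conj, mul_pow]
  ring

theorem Rep.tensor {α : ℝ} {h f : (ι → ℝ) → ℂ} (H : Rep α h f) :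
    Rep α (tensorDensity h)
      (fun z => f (z ∘ Sum.inl) * (starRingEnd ℂ) (f (z ∘ Sum.inr))) where
  measurable := by
    have hm := H.measurable
    have h1 : Measurable fun η : ι ⊕ ι → ℝ => η ∘ Sum.inl :=
      measurable_pi_lambda _ fun i => measurable_pi_apply _
    have h2 : Measurable fun η : ι ⊕ ι → ℝ => -(η ∘ Sum.inr) :=
      (measurable_pi_lambda _ fun i => measurable_pi_apply _).neg
    exact (hm.comp h1).mul (Complex.continuous_conj.measurable.comp (hm.comp h2))
  energy_ne_top := by
    rw [energy_tensorDensity α H.measurable]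
    exact ENNReal.pow_ne_top H.energy_ne_top
  eq z := by
    have hm := H.measurable
    have hp1 := measurable_phase (z ∘ Sum.inl)
    have hp2 := measurable_phase (z ∘ Sum.inr)
    have hms : Measurable fun p : (ι → ℝ) × (ι → ℝ) => (phase (z ∘ Sum.inl) p.1 * h p.1) *
        (starRingEnd ℂ) (phase (z ∘ Sum.inr) p.2 * h p.2) :=
      ((hp1.mul hm).comp measurable_fst).mul
        (Complex.continuous_conj.measurable.comp ((hp2.mul hm).comp measurable_snd))
    rw [H.eq, H.eq, ← integral_conj, ← integral_prod_mul,
      ← integral_comp_of_measurePreserving measurePreserving_sumSplit hms.aestronglyMeasurable]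
    refine integral_congr_ae (Filter.Eventually.of_forall fun η => ?_)
    have hph : phase z η = phase (z ∘ Sum.inl) (η ∘ Sum.inl) *
        (starRingEnd ℂ) (phase (z ∘ Sum.inr) (-(η ∘ Sum.inr))) := by
      simp only [phase, Fintype.sum_sum_type, Function.comp_apply, Pi.neg_apply, mul_neg,
        Finset.sum_neg_distrib, AddChar.map_add_eq_mul, Circle.coe_mul, AddChar.map_neg_eq_inv,
        Circle.coe_inv_eq_conj, Complex.conj_conj]
    simp only [hph, tensorDensity, map_mul]
    ring

end Tensor

/-! ### The extended-valued Sobolev norm. -/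

section SobolevNorm

variable {ι : Type} [Fintype ι]

/-- The norm `‖∏ᵢ (1 - ∂ᵢ²)^{α/2} g‖`, with value `∞` outside of the domain. -/
def sobolevNorm (α : ℝ) (g : L2 ι) : ENNReal :=
  eLpNorm (fun ξ => sobolevSymbol α ξ * (𝓕 g : L2 ι) ξ) 2 volume

theorem continuous_sobolevSymbol (α : ℝ) : Continuous (sobolevSymbol (ι := ι) α) := by
  unfold sobolevSymbol
  refine Complex.continuous_ofReal.comp (continuous_finsetProd _ fun i _ => ?_)
  refine Continuous.rpow_const (by fun_prop) fun ξ => Or.inl ?_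
  positivity

theorem enorm_sobolevSymbol_sq (α : ℝ) (ξ : EuclideanSpace ℝ ι) :
    ‖sobolevSymbol α ξ‖ₑ ^ 2 = weight α ξ.ofLp := by
  have h0 : ∀ x : ℝ, 0 ≤ (1 + (2 * Real.pi * x) ^ 2) ^ (α / 2) := fun x => by positivity
  rw [sobolevSymbol, ← ofReal_norm, Complex.norm_real, Real.norm_of_nonneg
    (Finset.prod_nonneg fun i _ => h0 _), ENNReal.ofReal_prod_of_nonneg fun i _ => h0 _,
    ← Finset.prod_pow, weight]
  refine Finset.prod_congr rfl fun i _ => ?_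
  rw [← ENNReal.ofReal_pow (h0 _), bracket, ← Real.rpow_natCast, ← Real.rpow_mul (by positivity)]
  norm_num

theorem sobolevSymbol_ne_zero (α : ℝ) (ξ : EuclideanSpace ℝ ι) : sobolevSymbol α ξ ≠ 0 := by
  intro h
  have := enorm_sobolevSymbol_sq α ξ
  rw [h] at this
  exact weight_ne_zero α ξ.ofLp (by simpa using this.symm)

theorem eLpNorm_two_sq {X : Type*} [MeasurableSpace X] {μ : Measure X} (f : X → ℂ) :
    eLpNorm f 2 μ ^ 2 = ∫⁻ x, ‖f x‖ₑ ^ 2 ∂μ := by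
  have := eLpNorm_nnreal_pow_eq_lintegral (p := 2) (μ := μ) (f := f) two_ne_zero
  simpa using this

theorem sobolevNorm_sq (α : ℝ) (g : L2 ι) :
    sobolevNorm α g ^ 2 = ∫⁻ ξ, weight α ξ.ofLp * ‖(𝓕 g : L2 ι) ξ‖ₑ ^ 2 := by
  rw [sobolevNorm, eLpNorm_two_sq]
  simp_rw [enorm_mul, mul_pow, enorm_sobolevSymbol_sq]

theorem aestronglyMeasurable_symbol_mul (α : ℝ) (g : L2 ι) :
    AEStronglyMeasurable (fun ξ => sobolevSymbol α ξ * (𝓕 g : L2 ι) ξ) volume :=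
  (continuous_sobolevSymbol α).aestronglyMeasurable.mul (Lp.aestronglyMeasurable _)

theorem inSobolev_iff {α : ℝ} {g : L2 ι} : InSobolev α g ↔ sobolevNorm α g < ⊤ :=
  ⟨fun h => h.2, fun h => ⟨aestronglyMeasurable_symbol_mul α g, h⟩⟩

theorem fourier_multiplier {m : EuclideanSpace ℝ ι → ℂ} {g : L2 ι} (h : InDomain m g) :
    (𝓕 (multiplier m g) : L2 ι) =ᵐ[volume] fun ξ => m ξ * (𝓕 g : L2 ι) ξ := by
  have e : multiplier m g = 𝓕⁻ (MemLp.toLp _ h : L2 ι) := dif_pos h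
  rw [e, FourierTransform.fourier_fourierInv_eq]
  exact MemLp.coeFn_toLp _

theorem norm_S {α : ℝ} {g : L2 ι} (h : InSobolev α g) : ‖S α g‖ = (sobolevNorm α g).toReal := by
  rw [S, ← Lp.norm_fourier_eq, Lp.norm_def, eLpNorm_congr_ae (fourier_multiplier h), sobolevNorm]

theorem sobolevNorm_eq_ofReal {α : ℝ} {g : L2 ι} (h : InSobolev α g) :
    sobolevNorm α g = ENNReal.ofReal ‖S α g‖ := by
  rw [norm_S h, ENNReal.ofReal_toReal (inSobolev_iff.1 h).ne]

theorem inSobolev_of_le {α : ℝ} {g : L2 ι} {M : ℝ} (h : sobolevNorm α g ≤ ENNReal.ofReal M) :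
    InSobolev α g := inSobolev_iff.2 (h.trans_lt ENNReal.ofReal_lt_top)

theorem norm_S_le {α : ℝ} {g : L2 ι} {M : ℝ} (hM : 0 ≤ M)
    (h : sobolevNorm α g ≤ ENNReal.ofReal M) : ‖S α g‖ ≤ M := by
  rw [norm_S (inSobolev_of_le h)]
  exact ENNReal.toReal_le_of_le_ofReal hM h

theorem eq_zero_of_sobolevNorm {α : ℝ} {g : L2 ι} (h : sobolevNorm α g = 0) : g = 0 := by
  rw [sobolevNorm, eLpNorm_eq_zero_iff (aestronglyMeasurable_symbol_mul α g) two_ne_zero] at h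
  have h2 : (𝓕 g : L2 ι) = 0 := by
    refine (Lp.eq_zero_iff_ae_eq_zero).2 ?_
    filter_upwards [h] with ξ hξ
    exact (mul_eq_zero.1 hξ).resolve_left (sobolevSymbol_ne_zero α ξ)
  rw [← norm_eq_zero, ← Lp.norm_fourier_eq, h2, norm_zero]

theorem sobolevNorm_add_le (α : ℝ) (g g' : L2 ι) :
    sobolevNorm α (g + g') ≤ sobolevNorm α g + sobolevNorm α g' := by
  refine le_trans (le_of_eq ?_) (eLpNorm_add_le (aestronglyMeasurable_symbol_mul α g)
    (aestronglyMeasurable_symbol_mul α g') (by norm_num))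
  rw [sobolevNorm, FourierAdd.fourier_add]
  refine eLpNorm_congr_ae ?_
  filter_upwards [Lp.coeFn_add (𝓕 g : L2 ι) (𝓕 g' : L2 ι)] with ξ hξ
  simp only [hξ, Pi.add_apply, mul_add]

theorem sobolevNorm_smul (α : ℝ) (c : ℂ) (g : L2 ι) :
    sobolevNorm α (c • g) = ‖c‖ₑ * sobolevNorm α g := by
  rw [sobolevNorm, sobolevNorm, ← eLpNorm_const_smul, FourierSMul.fourier_smul]
  refine eLpNorm_congr_ae ?_
  filter_upwards [Lp.coeFn_smul c (𝓕 g : L2 ι)] with ξ hξ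
  simp only [hξ, Pi.smul_apply, smul_eq_mul]
  ring

theorem sobolevNorm_neg (α : ℝ) (g : L2 ι) : sobolevNorm α (-g) = sobolevNorm α g := by
  rw [← neg_one_smul ℂ g, sobolevNorm_smul, enorm_neg, enorm_one, one_mul]

theorem sobolevNorm_zero (α : ℝ) : sobolevNorm α (0 : L2 ι) = 0 := by
  rw [← zero_smul ℂ (0 : L2 ι), sobolevNorm_smul, enorm_zero, zero_mul]

theorem sobolevNorm_sub_le (α : ℝ) (g g' : L2 ι) :
    sobolevNorm α (g - g') ≤ sobolevNorm α g + sobolevNorm α g' := by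
  rw [sub_eq_add_neg, ← sobolevNorm_neg α g']
  exact sobolevNorm_add_le α g (-g')

theorem sobolevNorm_sum_le {σ : Type*} (α : ℝ) (s : Finset σ) (g : σ → L2 ι) :
    sobolevNorm α (∑ i ∈ s, g i) ≤ ∑ i ∈ s, sobolevNorm α (g i) :=
  Finset.le_sum_of_subadditive _ (sobolevNorm_zero α).le (sobolevNorm_add_le α) _ _

theorem sobolevNorm_mono {α β : ℝ} (h : α ≤ β) (g : L2 ι) :
    sobolevNorm α g ≤ sobolevNorm β g := by
  rw [← ENNReal.pow_le_pow_left_iff two_ne_zero, sobolevNorm_sq, sobolevNorm_sq]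
  exact lintegral_mono fun ξ => mul_le_mul_left (weight_mono h _) _

end SobolevNorm

/-! ### Passage between spectral densities and elements of `L²`. -/

section Bridge

variable {ι : Type} [Fintype ι]

theorem fourierInv_comp_ofLp (h : (ι → ℝ) → ℂ) (hm : Measurable h) (x : EuclideanSpace ℝ ι) :
    (𝓕⁻ (fun ξ : EuclideanSpace ℝ ι => h ξ.ofLp) : EuclideanSpace ℝ ι → ℂ) x =
      ∫ η, phase x.ofLp η * h η := by
  rw [Real.fourierInv_eq, ← integral_comp_of_measurePreserving (PiLp.volume_preserving_ofLp ι)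
    (f := fun η => phase x.ofLp η * h η) ((measurable_phase _).mul hm).aestronglyMeasurable]
  refine integral_congr_ae (Filter.Eventually.of_forall fun ξ => ?_)
  simp only [phase, Circle.smul_def, smul_eq_mul, PiLp.inner_apply, RCLike.inner_apply, conj_trivial]

variable {α : ℝ} {h f : (ι → ℝ) → ℂ}

theorem Rep.integrable_ofLp (H : Rep α h f) (hα : 1 / 2 < α) :
    Integrable fun ξ : EuclideanSpace ℝ ι => h ξ.ofLp :=
  ((PiLp.volume_preserving_ofLp ι).integrable_comp
    H.measurable.aestronglyMeasurable).2 (H.integrable hα)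

theorem Rep.fourierInv_eq (H : Rep α h f) :
    (𝓕⁻ (fun ξ : EuclideanSpace ℝ ι => h ξ.ofLp) : EuclideanSpace ℝ ι → ℂ) =
      fun x => f x.ofLp := by
  ext x
  rw [fourierInv_comp_ofLp h H.measurable, H.eq]

theorem Rep.continuous (H : Rep α h f) (hα : 1 / 2 < α) :
    Continuous fun x : EuclideanSpace ℝ ι => f x.ofLp := by
  rw [← H.fourierInv_eq]
  exact continuous_fourierInv_of_integrable (H.integrable_ofLp hα)

theorem Rep.memLp_density (H : Rep α h f) (hα : 1 / 2 < α) :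
    MemLp (fun ξ : EuclideanSpace ℝ ι => h ξ.ofLp) 2 volume := by
  have hm := H.measurable
  refine ⟨(H.integrable_ofLp hα).1, ?_⟩
  rw [← ENNReal.pow_lt_top_iff (n := 2) |>.trans (or_iff_left two_ne_zero), eLpNorm_two_sq,
    (PiLp.volume_preserving_ofLp ι).lintegral_comp (f := fun η => ‖h η‖ₑ ^ 2) (by fun_prop)]
  exact (lintegral_enorm_sq_le_energy (by linarith) h).trans_lt H.energy_ne_top.lt_top

theorem Rep.fourierInv_toLp_ae (H : Rep α h f) (hα : 1 / 2 < α) :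
    (𝓕⁻ ((H.memLp_density hα).toLp _ : L2 ι) : L2 ι) =ᵐ[volume] fun x => f x.ofLp := by
  have := GPHierarchy.fourierInv_toLp_ae (H.integrable_ofLp hα) (H.memLp_density hα)
  rwa [H.fourierInv_eq] at this

theorem Rep.memLp (H : Rep α h f) (hα : 1 / 2 < α) :
    MemLp (fun x : EuclideanSpace ℝ ι => f x.ofLp) 2 volume :=
  (memLp_congr_ae (H.fourierInv_toLp_ae hα)).1 (Lp.memLp _)

theorem Rep.fourier_ae (H : Rep α h f) (hα : 1 / 2 < α) {g : L2 ι}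
    (hg : g =ᵐ[volume] fun x => f x.ofLp) :
    (𝓕 g : L2 ι) =ᵐ[volume] fun ξ => h ξ.ofLp := by
  have : g = 𝓕⁻ ((H.memLp_density hα).toLp _ : L2 ι) :=
    Lp.ext (hg.trans (H.fourierInv_toLp_ae hα).symm)
  rw [this, FourierTransform.fourier_fourierInv_eq]
  exact MemLp.coeFn_toLp _

theorem Rep.sobolevNorm_sq (H : Rep α h f) (hα : 1 / 2 < α) {g : L2 ι}
    (hg : g =ᵐ[volume] fun x => f x.ofLp) : sobolevNorm α g ^ 2 = energy α h := by
  have hw := measurable_weight (ι := ι) α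
  have hm := H.measurable
  rw [GPHierarchy.sobolevNorm_sq, energy,
    ← (PiLp.volume_preserving_ofLp ι).lintegral_comp (by fun_prop)]
  refine lintegral_congr_ae ?_
  filter_upwards [H.fourier_ae hα hg] with ξ hξ
  rw [hξ]

/-- The density is a measurable version of `𝓕 g`. It is integrable by `integrable_of_energy`, so its
Fourier integral makes sense at every point and is the continuous representative of `g`. -/
theorem exists_rep (hα : 1 / 2 < α) {g : L2 ι} (hg : sobolevNorm α g < ⊤) :
    ∃ h f : (ι → ℝ) → ℂ, Rep α h f ∧ g =ᵐ[volume] (fun x => f x.ofLp) := by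
  have hsm := Lp.aestronglyMeasurable (𝓕 g : L2 ι)
  set u := hsm.mk _ with hu
  have hum : Measurable u := hsm.stronglyMeasurable_mk.measurable
  have hw := measurable_weight (ι := ι) α
  let h : (ι → ℝ) → ℂ := fun η => u (WithLp.toLp 2 η)
  have hm : Measurable h := hum.comp (PiLp.volume_preserving_toLp ι).measurable
  have he : energy α h ≠ ⊤ := by
    rw [energy, ← (PiLp.volume_preserving_ofLp ι).lintegral_comp (by fun_prop)]
    refine ne_of_eq_of_ne ?_ (ENNReal.pow_ne_top (n := 2) hg.ne)
    rw [GPHierarchy.sobolevNorm_sq]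
    refine lintegral_congr_ae ?_
    filter_upwards [hsm.ae_eq_mk] with ξ hξ
    rw [hξ]
  have H : Rep α h (fun x => ∫ η, phase x η * h η) := ⟨hm, he, fun x => rfl⟩
  refine ⟨h, _, H, ?_⟩
  have e : ((H.memLp_density hα).toLp _ : L2 ι) = 𝓕 g :=
    Lp.ext ((MemLp.coeFn_toLp _).trans hsm.ae_eq_mk.symm)
  have := H.fourierInv_toLp_ae hα
  rwa [e, FourierTransform.fourierInv_fourier_eq] at this

end Bridge

/-! ### Boundedness and linearity of the contraction operators. -/

section Contraction

variable {k : ℕ} {α : ℝ}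

/-- Continuous functions that agree almost everywhere agree everywhere, because Lebesgue measure
charges nonempty open sets; the choice in the definition is therefore immaterial. -/
theorem continuousRep_eq {γ : Kernel k} {f : EuclideanSpace ℝ (Fin k ⊕ Fin k) → ℂ}
    (hf : Continuous f) (h : γ =ᵐ[volume] f) : continuousRep γ = f := by
  have hex : ∃ f : EuclideanSpace ℝ (Fin k ⊕ Fin k) → ℂ, Continuous f ∧ γ =ᵐ[volume] f :=
    ⟨f, hf, h⟩
  rw [continuousRep, dif_pos hex]
  have hs := Classical.choose_spec hex
  exact (hs.1.ae_eq_iff_eq volume hf).1 (hs.2.symm.trans h)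

/-- The map of coordinates that sends the inserted ones to `c`. -/
def insertIndex (p : ℕ) (c : Fin k ⊕ Fin k) : Fin (k + p) ⊕ Fin (k + p) → Fin k ⊕ Fin k :=
  Sum.elim (Fin.append Sum.inl fun _ : Fin p => c) (Fin.append Sum.inr fun _ : Fin p => c)

theorem insertIndex_surjective (p : ℕ) (c : Fin k ⊕ Fin k) :
    Function.Surjective (insertIndex p c) := by
  rintro (i | i)
  · exact ⟨Sum.inl (Fin.castAdd p i), by simp [insertIndex]⟩
  · exact ⟨Sum.inr (Fin.castAdd p i), by simp [insertIndex]⟩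

/-- Exhibits a contraction as a pullback along a surjection of index sets, the setting of
`Rep.comp_surjective`. -/
theorem ofLp_insertPoint (p : ℕ) (c : Fin k ⊕ Fin k) (z : EuclideanSpace ℝ (Fin k ⊕ Fin k)) :
    (insertPoint p (z c) z).ofLp = z.ofLp ∘ insertIndex p c := by
  ext i
  rcases i with i | i <;>
  · simp only [insertPoint, insertIndex, Sum.elim_inl, Sum.elim_inr, Function.comp_apply]
    induction i using Fin.addCases <;> simp

theorem Rep.insert (hα : 1 / 2 < α) (h1 : α ≤ 1) (p : ℕ) (c : Fin k ⊕ Fin k)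
    {h f : (Fin (k + p) ⊕ Fin (k + p) → ℝ) → ℂ} (H : Rep α h f) :
    ∃ h' : (Fin k ⊕ Fin k → ℝ) → ℂ, Rep α h' (fun x => f (x ∘ insertIndex p c)) ∧
        energy α h' ≤ restrictConst α ^ (2 * p) * energy α h :=
  -- Each of the `p` contracted particles contributes an unprimed and a primed coordinate, hence
  -- `2p` restrictions.
  Rep.comp_surjective hα h1 (2 * p) _ (insertIndex_surjective p c)
    (by simp only [Fintype.card_sum, Fintype.card_fin]; ring) H

theorem exists_rep_contract (hα : 1 / 2 < α) (h1 : α ≤ 1) (p : ℕ) (j : Fin k)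
    {γ : Kernel (k + p)} (hγ : sobolevNorm α γ < ⊤) :
    ∃ h f : (Fin k ⊕ Fin k → ℝ) → ℂ, Rep α h f ∧
      (fun z => contractPlus p j (continuousRep γ) z - contractMinus p j (continuousRep γ) z) =
        (fun z => f z.ofLp) ∧
      energy α h ≤ 4 * restrictConst α ^ (2 * p) * sobolevNorm α γ ^ 2 := by
  obtain ⟨h, f, H, hf⟩ := exists_rep hα hγ
  obtain ⟨u, Hu, hu⟩ := H.insert hα h1 p (Sum.inl j)
  obtain ⟨v, Hv, hv⟩ := H.insert hα h1 p (Sum.inr j)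
  refine ⟨u - v, _, Hu.sub hα Hv, ?_, ?_⟩
  · rw [continuousRep_eq (H.continuous hα) hf]
    ext z
    simp only [contractPlus, contractMinus, ofLp_insertPoint, Pi.sub_apply]
  · rw [H.sobolevNorm_sq hα hf]
    calc energy α (u - v) ≤ 2 * (energy α u + energy α v) := energy_sub_le α Hu.measurable
      _ ≤ 2 * (restrictConst α ^ (2 * p) * energy α h +
          restrictConst α ^ (2 * p) * energy α h) := by gcongr
      _ = _ := by ring

theorem memLp_contract (hα : 1 / 2 < α) (h1 : α ≤ 1) (p : ℕ) (j : Fin k)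
    {γ : Kernel (k + p)} (hγ : sobolevNorm α γ < ⊤) :
    MemLp (fun z => contractPlus p j (continuousRep γ) z
      - contractMinus p j (continuousRep γ) z) 2 volume := by
  obtain ⟨h, f, H, e, -⟩ := exists_rep_contract hα h1 p j hγ
  rw [e]
  exact H.memLp hα

theorem B_ae (hα : 1 / 2 < α) (h1 : α ≤ 1) (p : ℕ) (j : Fin k)
    {γ : Kernel (k + p)} (hγ : sobolevNorm α γ < ⊤) :
    B p j γ =ᵐ[volume] fun z => contractPlus p j (continuousRep γ) z
      - contractMinus p j (continuousRep γ) z := by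
  rw [B, dif_pos (memLp_contract hα h1 p j hγ)]
  exact MemLp.coeFn_toLp _

theorem sobolevNorm_B_le (hα : 1 / 2 < α) (h1 : α ≤ 1) (p : ℕ) (j : Fin k)
    {γ : Kernel (k + p)} (hγ : sobolevNorm α γ < ⊤) :
    sobolevNorm α (B p j γ) ≤ 2 * restrictConst α ^ p * sobolevNorm α γ := by
  obtain ⟨h, f, H, e, hE⟩ := exists_rep_contract hα h1 p j hγ
  have hB := B_ae hα h1 p j hγ
  rw [e] at hB
  rw [← ENNReal.pow_le_pow_left_iff two_ne_zero, H.sobolevNorm_sq hα hB]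
  refine hE.trans (le_of_eq ?_)
  ring

/-- Linearity is not built into `B`, which chooses a representative and has a default value. It
holds on the Sobolev domain because the difference of the continuous representatives is the
continuous representative of the difference. -/
theorem B_sub (hα : 1 / 2 < α) (h1 : α ≤ 1) (p : ℕ) (j : Fin k)
    {γ γ' : Kernel (k + p)} (hγ : sobolevNorm α γ < ⊤) (hγ' : sobolevNorm α γ' < ⊤) :
    B p j (γ - γ') = B p j γ - B p j γ' := by
  have hs : sobolevNorm α (γ - γ') < ⊤ :=
    (sobolevNorm_sub_le α γ γ').trans_lt (ENNReal.add_lt_top.2 ⟨hγ, hγ'⟩)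
  obtain ⟨h, f, H, hf⟩ := exists_rep hα hγ
  obtain ⟨h', f', H', hf'⟩ := exists_rep hα hγ'
  have e : continuousRep (γ - γ') = continuousRep γ - continuousRep γ' := by
    rw [continuousRep_eq (H.continuous hα) hf, continuousRep_eq (H'.continuous hα) hf']
    exact continuousRep_eq ((H.continuous hα).sub (H'.continuous hα))
      ((Lp.coeFn_sub γ γ').trans (hf.sub hf'))
  refine Lp.ext ?_
  filter_upwards [B_ae hα h1 p j hγ, B_ae hα h1 p j hγ', B_ae hα h1 p j hs,
    Lp.coeFn_sub (B p j γ) (B p j γ')] with z e1 e2 e3 e4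
  rw [e3, e4, Pi.sub_apply, e1, e2, e]
  simp only [contractPlus, contractMinus, Pi.sub_apply]
  ring

end Contraction

/-! ### Isometry and linearity of the free evolution. -/

section Evolution

variable {k : ℕ} {α : ℝ}

theorem norm_evolutionSymbol (t : ℝ) (ξ : EuclideanSpace ℝ (Fin k ⊕ Fin k)) :
    ‖evolutionSymbol t ξ‖ = 1 := by
  unfold evolutionSymbol
  rw [Complex.norm_exp]
  simp [-Complex.ofReal_sub, -Complex.ofReal_sum]

theorem fourier_U (t : ℝ) (γ : Kernel k) :
    (𝓕 (U t γ) : Kernel k) =ᵐ[volume] fun ξ => evolutionSymbol t ξ * (𝓕 γ : Kernel k) ξ :=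
  fourier_multiplier (inDomain_evolutionSymbol t γ)

theorem sobolevNorm_U (t : ℝ) (γ : Kernel k) : sobolevNorm α (U t γ) = sobolevNorm α γ := by
  refine (ENNReal.pow_right_strictMono two_ne_zero).injective ?_
  simp only [sobolevNorm_sq]
  refine lintegral_congr_ae ?_
  filter_upwards [fourier_U t γ] with ξ hξ
  rw [hξ, enorm_mul, ← ofReal_norm (evolutionSymbol t ξ), norm_evolutionSymbol,
    ENNReal.ofReal_one, one_mul]

theorem fourier_sub {ι : Type} [Fintype ι] (g g' : L2 ι) :
    (𝓕 (g - g') : L2 ι) = 𝓕 g - 𝓕 g' :=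
  (Lp.fourierTransformₗᵢ (EuclideanSpace ℝ ι) ℂ).map_sub g g'

theorem fourier_injective {ι : Type} [Fintype ι] :
    Function.Injective (𝓕 : L2 ι → L2 ι) :=
  (Lp.fourierTransformₗᵢ (EuclideanSpace ℝ ι) ℂ).injective

theorem U_sub (t : ℝ) (γ γ' : Kernel k) : U t (γ - γ') = U t γ - U t γ' := by
  refine fourier_injective (Lp.ext ?_)
  rw [fourier_sub]
  have h := fourier_U t (γ - γ')
  rw [fourier_sub] at h
  filter_upwards [h, fourier_U t γ, fourier_U t γ',
    Lp.coeFn_sub (𝓕 (U t γ) : Kernel k) (𝓕 (U t γ') : Kernel k),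
    Lp.coeFn_sub (𝓕 γ : Kernel k) (𝓕 γ' : Kernel k)] with ξ h1 h2 h3 h4 h5
  rw [h1, h4, Pi.sub_apply, h2, h3, h5, Pi.sub_apply, mul_sub]

theorem U_zero (t : ℝ) : U t (0 : Kernel k) = 0 := by
  have := U_sub t (0 : Kernel k) 0
  simpa using this

end Evolution

/-! ### Sobolev norms of `L²`-valued integrals and series. -/

section Truncation

variable {ι : Type} [Fintype ι]

/-- The symbol of `∏ᵢ (1 - ∂ᵢ²)^{α/2}` cut off outside of the ball of radius `R`. -/
def truncSymbol (α : ℝ) (R : ℕ) : EuclideanSpace ℝ ι → ℂ :=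
  (Metric.closedBall 0 R).indicator (sobolevSymbol α)

theorem measurable_truncSymbol (α : ℝ) (R : ℕ) : Measurable (truncSymbol (ι := ι) α R) :=
  (continuous_sobolevSymbol α).measurable.indicator measurableSet_closedBall

theorem norm_truncSymbol_le (α : ℝ) (R : ℕ) (ξ : EuclideanSpace ℝ ι) :
    ‖truncSymbol α R ξ‖ ≤ ‖sobolevSymbol α ξ‖ :=
  Set.indicator_le_self' (f := fun ξ => ‖sobolevSymbol α ξ‖) (fun _ _ => norm_nonneg _) ξ
    |>.trans' (norm_indicator_eq_indicator_norm _ _).le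

theorem exists_norm_truncSymbol_le (α : ℝ) (R : ℕ) :
    ∃ c : ℝ, ∀ ξ : EuclideanSpace ℝ ι, ‖truncSymbol α R ξ‖ ≤ c := by
  obtain ⟨c, hc⟩ := (isCompact_closedBall (0 : EuclideanSpace ℝ ι) R).exists_bound_of_continuousOn
    (continuous_sobolevSymbol α).continuousOn
  refine ⟨max c 0, fun ξ => ?_⟩
  by_cases h : ξ ∈ Metric.closedBall (0 : EuclideanSpace ℝ ι) R
  · rw [truncSymbol, Set.indicator_of_mem h]
    exact (hc ξ h).trans (le_max_left _ _)
  · rw [truncSymbol, Set.indicator_of_notMem h, norm_zero]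
    exact le_max_right _ _

theorem memLp_truncSymbol_mul (α : ℝ) (R : ℕ) (g : L2 ι) :
    MemLp (fun ξ => truncSymbol α R ξ * g ξ) 2 volume := by
  obtain ⟨c, hc⟩ := exists_norm_truncSymbol_le (ι := ι) α R
  refine MemLp.of_le_mul (c := c) (Lp.memLp g)
    ((measurable_truncSymbol α R).aestronglyMeasurable.mul (Lp.aestronglyMeasurable _))
    (Filter.Eventually.of_forall fun ξ => ?_)
  rw [norm_mul]
  exact mul_le_mul_of_nonneg_right (hc ξ) (norm_nonneg _)

/-- Multiplication by the truncated symbol, as a bounded operator on `L²`. -/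
def truncMul (α : ℝ) (R : ℕ) : L2 ι →L[ℂ] L2 ι :=
  LinearMap.mkContinuousOfExistsBound
    { toFun := fun g => (memLp_truncSymbol_mul α R g).toLp _
      map_add' := fun g g' => by
        refine Lp.ext ?_
        filter_upwards [(memLp_truncSymbol_mul α R (g + g')).coeFn_toLp,
          (memLp_truncSymbol_mul α R g).coeFn_toLp, (memLp_truncSymbol_mul α R g').coeFn_toLp,
          Lp.coeFn_add ((memLp_truncSymbol_mul α R g).toLp _)
            ((memLp_truncSymbol_mul α R g').toLp _), Lp.coeFn_add g g'] with ξ h1 h2 h3 h4 h5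
        rw [h1, h4, Pi.add_apply, h2, h3, h5, Pi.add_apply, mul_add]
      map_smul' := fun c g => by
        refine Lp.ext ?_
        filter_upwards [(memLp_truncSymbol_mul α R (c • g)).coeFn_toLp,
          (memLp_truncSymbol_mul α R g).coeFn_toLp,
          Lp.coeFn_smul c ((memLp_truncSymbol_mul α R g).toLp _),
          Lp.coeFn_smul c g] with ξ h1 h2 h3 h4
        rw [h1, RingHom.id_apply, h3, Pi.smul_apply, h2, h4, Pi.smul_apply, smul_eq_mul,
          smul_eq_mul, mul_left_comm] }
    (by
      obtain ⟨c, hc⟩ := exists_norm_truncSymbol_le (ι := ι) α R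
      refine ⟨c, fun g => ?_⟩
      refine Lp.norm_le_mul_norm_of_ae_le_mul ?_
      filter_upwards [(memLp_truncSymbol_mul α R g).coeFn_toLp] with ξ h1
      simp only [LinearMap.coe_mk, AddHom.coe_mk]
      rw [h1, norm_mul]
      exact mul_le_mul_of_nonneg_right (hc ξ) (norm_nonneg _))

/-- The Fourier multiplier with the truncated symbol, on the Fourier side. -/
def truncFourier (α : ℝ) (R : ℕ) : L2 ι →L[ℂ] L2 ι :=
  truncMul α R ∘L (Lp.fourierTransformₗᵢ (EuclideanSpace ℝ ι) ℂ).toContinuousLinearEquiv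

theorem enorm_truncFourier (α : ℝ) (R : ℕ) (g : L2 ι) :
    ‖truncFourier α R g‖ₑ = eLpNorm (fun ξ => truncSymbol α R ξ * (𝓕 g : L2 ι) ξ) 2 volume := by
  rw [Lp.enorm_def]
  exact eLpNorm_congr_ae (memLp_truncSymbol_mul α R (𝓕 g : L2 ι)).coeFn_toLp

theorem enorm_truncFourier_le (α : ℝ) (R : ℕ) (g : L2 ι) :
    ‖truncFourier α R g‖ₑ ≤ sobolevNorm α g := by
  rw [enorm_truncFourier, sobolevNorm]
  refine eLpNorm_mono fun ξ => ?_
  rw [norm_mul, norm_mul]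
  exact mul_le_mul_of_nonneg_right (norm_truncSymbol_le α R ξ) (norm_nonneg _)

/-- Fatou's lemma: at each frequency the truncated symbol equals the full one once `R` is large. -/
theorem sobolevNorm_le_of_truncFourier {α : ℝ} {g : L2 ι} {M : ENNReal}
    (h : ∀ R, ‖truncFourier α R g‖ₑ ≤ M) : sobolevNorm α g ≤ M := by
  refine (Lp.eLpNorm_lim_le_liminf_eLpNorm
    (f := fun R ξ => truncSymbol α R ξ * (𝓕 g : L2 ι) ξ)
    (fun R => (memLp_truncSymbol_mul α R _).1) _ ?_).trans ?_
  · refine Filter.Eventually.of_forall fun ξ => tendsto_const_nhds.congr' ?_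
    obtain ⟨N, hN⟩ := exists_nat_ge ‖ξ‖
    filter_upwards [Filter.eventually_ge_atTop N] with R hR
    rw [truncSymbol, Set.indicator_of_mem]
    rw [mem_closedBall_zero_iff]
    exact hN.trans (by exact_mod_cast hR)
  · refine Filter.liminf_le_of_frequently_le' (Filter.Eventually.frequently
      (Filter.Eventually.of_forall fun R => ?_))
    rw [← enorm_truncFourier]
    exact h R

/-- The integral is only known to converge in `L²`, where `S` is unbounded. The truncations are
bounded and commute with the integral, and the cutoff is then removed by Fatou, so no integrability
or measurability of `S α (F s)` is needed. -/
theorem sobolevNorm_integral_le {X : Type*} [MeasurableSpace X] {μ : Measure X} (α : ℝ)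
    (F : X → L2 ι) : sobolevNorm α (∫ s, F s ∂μ) ≤ ∫⁻ s, sobolevNorm α (F s) ∂μ := by
  by_cases hF : Integrable F μ
  · refine sobolevNorm_le_of_truncFourier fun R => ?_
    rw [← ContinuousLinearMap.integral_comp_comm _ hF]
    exact (enorm_integral_le_lintegral_enorm _).trans
      (lintegral_mono fun s => enorm_truncFourier_le α R (F s))
  -- A non-integrable `F` has Bochner integral `0` by convention.
  · rw [integral_undef hF, sobolevNorm_zero]
    exact zero_le

theorem sobolevNorm_le_of_hasSum {α : ℝ} {g : ℕ → L2 ι} {γ : L2 ι} (h : HasSum g γ) :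
    sobolevNorm α γ ≤ ∑' n, sobolevNorm α (g n) := by
  refine sobolevNorm_le_of_truncFourier fun R => ?_
  have ht := (h.mapL (truncFourier α R)).enorm
  refine le_of_tendsto ht (Filter.Eventually.of_forall fun s => ?_)
  calc ‖∑ n ∈ s, truncFourier α R (g n)‖ₑ ≤ ∑ n ∈ s, ‖truncFourier α R (g n)‖ₑ := enorm_sum_le _ _
    _ ≤ ∑ n ∈ s, sobolevNorm α (g n) :=
      Finset.sum_le_sum fun n _ => enorm_truncFourier_le α R (g n)
    _ ≤ ∑' n, sobolevNorm α (g n) := ENNReal.sum_le_tsum s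

end Truncation

/-! ### The energy class is contained in the Sobolev class. -/

section EnergyClass

variable {ι : Type} [Fintype ι]

theorem quasiMeasurePreserving_inl :
    Measure.QuasiMeasurePreserving (fun z : EuclideanSpace ℝ (ι ⊕ ι) =>
      (WithLp.toLp 2 fun i => z (Sum.inl i) : EuclideanSpace ℝ ι)) volume volume := by
  have h1 := (volume_measurePreserving_sumPiEquivProdPi (fun _ : ι ⊕ ι => ℝ)).comp
    (PiLp.volume_preserving_ofLp (ι ⊕ ι))
  exact (PiLp.volume_preserving_toLp ι).quasiMeasurePreserving.comp
    ((Measure.quasiMeasurePreserving_fst (μ := (volume : Measure (ι → ℝ)))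
      (ν := (volume : Measure (ι → ℝ)))).comp h1.quasiMeasurePreserving)

theorem quasiMeasurePreserving_inr :
    Measure.QuasiMeasurePreserving (fun z : EuclideanSpace ℝ (ι ⊕ ι) =>
      (WithLp.toLp 2 fun i => z (Sum.inr i) : EuclideanSpace ℝ ι)) volume volume := by
  have h1 := (volume_measurePreserving_sumPiEquivProdPi (fun _ : ι ⊕ ι => ℝ)).comp
    (PiLp.volume_preserving_ofLp (ι ⊕ ι))
  exact (PiLp.volume_preserving_toLp ι).quasiMeasurePreserving.comp
    ((Measure.quasiMeasurePreserving_snd (μ := (volume : Measure (ι → ℝ)))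
      (ν := (volume : Measure (ι → ℝ)))).comp h1.quasiMeasurePreserving)

/-- The weight is a product over coordinates and even in each of them, so the energy integral
factors into two equal ones. -/
theorem sobolevNorm_tensor {α : ℝ} (hα : 1 / 2 < α) {ψ : L2 ι} (hψ : sobolevNorm α ψ < ⊤)
    {g : L2 (ι ⊕ ι)} (hg : g =ᵐ[volume] fun z =>
      ψ (WithLp.toLp 2 fun i => z (Sum.inl i)) *
        (starRingEnd ℂ) (ψ (WithLp.toLp 2 fun i => z (Sum.inr i)))) :
    sobolevNorm α g = sobolevNorm α ψ ^ 2 := by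
  obtain ⟨h, f, H, hf⟩ := exists_rep hα hψ
  have hg' : g =ᵐ[volume] fun z : EuclideanSpace ℝ (ι ⊕ ι) =>
      f (z.ofLp ∘ Sum.inl) * (starRingEnd ℂ) (f (z.ofLp ∘ Sum.inr)) := by
    filter_upwards [hg, quasiMeasurePreserving_inl.ae hf, quasiMeasurePreserving_inr.ae hf]
      with z h1 h2 h3
    rw [h1, h2, h3]
    rfl
  refine (ENNReal.pow_right_strictMono two_ne_zero).injective ?_
  rw [H.tensor.sobolevNorm_sq hα hg', energy_tensorDensity α H.measurable, H.sobolevNorm_sq hα hf]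

/-- The triangle inequality over the rank-one terms, each of norm `‖S α ψₙ‖²`, which is at most `‖S
1 ψₙ‖²` since `α ≤ 1`; the sum of the latter is the energy trace. -/
theorem EnergyBound.sobolevNorm_le {k : ℕ} {α E : ℝ} (hα : 1 / 2 < α) (h1 : α ≤ 1)
    {γ : Kernel k} (h : EnergyBound E γ) : sobolevNorm α γ ≤ ENNReal.ofReal E := by
  obtain ⟨ψ, g, hg, hsum, hψ, hs, hE⟩ := h
  refine (sobolevNorm_le_of_hasSum hsum).trans (le_trans ?_ (ENNReal.ofReal_le_ofReal hE))
  rw [ENNReal.ofReal_tsum_of_nonneg (fun n => sq_nonneg _) hs]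
  refine ENNReal.tsum_le_tsum fun n => ?_
  have hm := sobolevNorm_mono h1 (ψ n)
  rw [sobolevNorm_tensor hα (hm.trans_lt (inSobolev_iff.1 (hψ n))) (hg n),
    ENNReal.ofReal_pow (norm_nonneg _), ← sobolevNorm_eq_ofReal (hψ n)]
  gcongr

end EnergyClass

/-! ### Iteration of the Duhamel formula. -/

section Duhamel

/-- A bound for the constant of the contraction operators of at most `q` pairs of variables. -/
def contractConst (α : ℝ) (q : ℕ) : ℝ := 2 * max 1 (restrictConst α).toReal ^ q

theorem contractConst_pos (α : ℝ) (q : ℕ) : 0 < contractConst α q := by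
  unfold contractConst
  positivity

/-- Replacing the base by its maximum with `1` lets a single constant serve all `p ≤ q`. -/
theorem sobolevNorm_B_le_contractConst {k : ℕ} {α : ℝ} (hα : 1 / 2 < α) (h1 : α ≤ 1) {p q : ℕ}
    (hpq : p ≤ q) (j : Fin k) {γ : Kernel (k + p)} (hγ : sobolevNorm α γ < ⊤) :
    sobolevNorm α (B p j γ) ≤ ENNReal.ofReal (contractConst α q) * sobolevNorm α γ := by
  refine (sobolevNorm_B_le hα h1 p j hγ).trans ?_
  gcongr
  have hfin : restrictConst α ≠ ⊤ := ENNReal.mul_ne_top (by norm_num) (bracketMass_ne_top hα)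
  rw [contractConst, ENNReal.ofReal_mul (by norm_num), ENNReal.ofReal_ofNat,
    ENNReal.ofReal_pow (by positivity)]
  refine mul_le_mul' le_rfl ?_
  calc restrictConst α ^ p ≤ ENNReal.ofReal (max 1 (restrictConst α).toReal) ^ p := by
        gcongr
        exact (ENNReal.le_ofReal_iff_toReal_le hfin (by positivity)).2 (le_max_right _ _)
    _ ≤ ENNReal.ofReal (max 1 (restrictConst α).toReal) ^ q :=
        pow_le_pow_right₀ (ENNReal.one_le_ofReal.2 (le_max_left _ _)) hpq

/-- The bound for the `n`-fold iterated Duhamel expansion at time `t`. -/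
def duhamelBound (M L : ℝ) (q k n : ℕ) (t : ℝ) : ℝ :=
  M ^ (k + n * q) * L ^ n * (∏ l ∈ Finset.range n, ((k : ℝ) + l * q)) / n.factorial * t ^ n

theorem duhamelBound_mono {M L : ℝ} (hM : 1 ≤ M) (hL : 0 ≤ L) (q : ℕ) {k k' : ℕ} (hk : k ≤ k')
    (n : ℕ) {t : ℝ} (ht : 0 ≤ t) : duhamelBound M L q k n t ≤ duhamelBound M L q k' n t := by
  unfold duhamelBound
  have : (k : ℝ) ≤ k' := by exact_mod_cast hk
  gcongr

theorem duhamelBound_nonneg {M L : ℝ} (hM : 1 ≤ M) (hL : 0 ≤ L) (q k n : ℕ) {t : ℝ}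
    (ht : 0 ≤ t) : 0 ≤ duhamelBound M L q k n t := by
  unfold duhamelBound
  positivity

theorem lintegral_duhamelBound {M L : ℝ} (hM : 1 ≤ M) (hL : 0 ≤ L) (q k n : ℕ) {t : ℝ}
    (ht : 0 ≤ t) :
    ∫⁻ s in Set.Ioc 0 t, ENNReal.ofReal (duhamelBound M L q k n s) =
      ENNReal.ofReal (duhamelBound M L q k n t * t / (n + 1)) := by
  have hc : Continuous (duhamelBound M L q k n) := by
    unfold duhamelBound
    fun_prop
  rw [← ofReal_integral_eq_lintegral_ofReal]
  · rw [← intervalIntegral.integral_of_le ht]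
    congr 1
    simp only [duhamelBound, intervalIntegral.integral_const_mul, integral_pow]
    rw [zero_pow (Nat.succ_ne_zero n)]
    ring
  · exact hc.integrableOn_Ioc
  · exact (ae_restrict_mem measurableSet_Ioc).mono fun s hs =>
      duhamelBound_nonneg hM hL q k n hs.1.le

/-- The recursion produced by one Duhamel step: `q` bounds the number of `p`, `b` the coefficients,
`k` counts the `j`, `D` bounds the contraction, and `t/(n+1)` comes from integrating `s^n`. The
leading factor `k` of the product splits off and shifts the order to `k + q`. -/
theorem duhamelBound_succ (M b D : ℝ) (q k n : ℕ) (t : ℝ) :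
    duhamelBound M (b * q * D) q k (n + 1) t =
      q * (b * (k * (D * (duhamelBound M (b * q * D) q (k + q) n t * t / (n + 1))))) := by
  have hprod : ∏ l ∈ Finset.range (n + 1), ((k : ℝ) + l * q) =
      (∏ l ∈ Finset.range n, (((k + q : ℕ) : ℝ) + l * q)) * k := by
    rw [Finset.prod_range_succ']
    push_cast
    congr 1
    · exact Finset.prod_congr rfl fun l _ => by ring
    · ring
  unfold duhamelBound
  rw [hprod, Nat.factorial_succ, show k + (n + 1) * q = k + q + n * q by ring]
  push_cast
  have h1 : ((n : ℝ) + 1) ≠ 0 := by positivity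
  have h2 : (n.factorial : ℝ) ≠ 0 := by positivity
  field_simp
  ring

/-- Since `k + lq ≤ q(k + l)`, the product is at most `q^n` times a rising factorial, that is, `n!`
times a binomial coefficient below `2^{k+n}`. The `n!` of the time simplex thus absorbs the
factorial growth of the number of terms. -/
theorem duhamelBound_le {M L t T : ℝ} (hM : 1 ≤ M) (hL : 0 ≤ L) (ht : 0 ≤ t) (htT : t ≤ T)
    {q k : ℕ} (hq : 1 ≤ q) (n : ℕ) :
    duhamelBound M L q k n t ≤ (2 * M) ^ k * (2 * M ^ q * L * q * T) ^ n := by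
  have hprod : ∏ l ∈ Finset.range n, ((k : ℝ) + l * q) ≤ q ^ n * (2 ^ (k + n) * n.factorial) := by
    have hq' : (1 : ℝ) ≤ q := by exact_mod_cast hq
    calc ∏ l ∈ Finset.range n, ((k : ℝ) + l * q)
        ≤ ∏ l ∈ Finset.range n, ((q : ℝ) * ((k + l : ℕ) : ℝ)) := by
          refine Finset.prod_le_prod (fun l _ => by positivity) fun l _ => ?_
          push_cast
          nlinarith [Nat.cast_nonneg (α := ℝ) k]
      _ = q ^ n * (k.ascFactorial n : ℕ) := by
          rw [Finset.prod_mul_distrib, Finset.prod_const, Finset.card_range,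
            Nat.ascFactorial_eq_prod_range, Nat.cast_prod]
      _ ≤ q ^ n * (2 ^ (k + n) * n.factorial) := by
          gcongr
          rw [Nat.ascFactorial_eq_factorial_mul_choose', mul_comm]
          have : (k + n - 1).choose n ≤ 2 ^ (k + n) :=
            (Nat.choose_le_two_pow _ _).trans (Nat.pow_le_pow_right (by norm_num) (Nat.sub_le _ _))
          exact_mod_cast Nat.mul_le_mul_right _ this
  unfold duhamelBound
  have hM0 : 0 ≤ M := by linarith
  calc M ^ (k + n * q) * L ^ n * (∏ l ∈ Finset.range n, ((k : ℝ) + l * q)) / n.factorial * t ^ n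
      ≤ M ^ (k + n * q) * L ^ n * (q ^ n * (2 ^ (k + n) * n.factorial)) / n.factorial * T ^ n := by
        gcongr
    _ = (2 * M) ^ k * (2 * M ^ q * L * q * T) ^ n := by
        have h2 : (n.factorial : ℝ) ≠ 0 := by positivity
        field_simp
        ring

variable {p₀ q : ℕ} {α b₀ M T : ℝ} {b : ℕ → ℝ} {Γ : (k : ℕ) → ℝ → Kernel k}

/-- Iterating the Duhamel formula with zero initial data. -/
theorem sobolevNorm_le_duhamelBound (hα : 1 / 2 < α) (h1 : α ≤ 1) (hM : 1 ≤ M) (hpq : p₀ ≤ q)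
    (hb0 : ∀ p ∈ Set.Icc 1 p₀, 0 ≤ b p) (hb : ∀ p ∈ Set.Icc 1 p₀, b p ≤ b₀) (hb₀ : 0 ≤ b₀)
    (hΓ : ∀ k, 1 ≤ k → ∀ t ∈ Set.Icc 0 T, sobolevNorm α (Γ k t) ≤ ENNReal.ofReal (M ^ k))
    (hD : ∀ k, 1 ≤ k → ∀ t ∈ Set.Icc 0 T, Γ k t = -(Complex.I • ∑ p ∈ Finset.Icc 1 p₀,
      (b p : ℂ) • ∑ j : Fin k, ∫ s in (0 : ℝ)..t, U (t - s) (B p j (Γ (k + p) s))))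
    (n : ℕ) : ∀ k, 1 ≤ k → ∀ t ∈ Set.Icc 0 T, sobolevNorm α (Γ k t) ≤
      ENNReal.ofReal (duhamelBound M (b₀ * q * contractConst α q) q k n t) := by
  have hDp := contractConst_pos α q
  set D := contractConst α q with hDdef
  have hL : 0 ≤ b₀ * q * D := by positivity
  induction n with
  | zero =>
    intro k hk t ht
    simpa [duhamelBound] using hΓ k hk t ht
  | succ n ih =>
    intro k hk t ht
    set X := duhamelBound M (b₀ * q * D) q (k + q) n t * t / (n + 1) with hX
    have hX0 : 0 ≤ X := by
      have := duhamelBound_nonneg hM hL q (k + q) n ht.1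
      have := ht.1
      positivity
    have hint : ∀ p ∈ Finset.Icc 1 p₀, ∀ j : Fin k,
        sobolevNorm α (∫ s in (0 : ℝ)..t, U (t - s) (B p j (Γ (k + p) s))) ≤
          ENNReal.ofReal (D * X) := by
      intro p hp j
      have hpq' : p ≤ q := (Finset.mem_Icc.1 hp).2.trans hpq
      rw [intervalIntegral.integral_of_le ht.1]
      calc sobolevNorm α (∫ s in Set.Ioc 0 t, U (t - s) (B p j (Γ (k + p) s)))
          ≤ ∫⁻ s in Set.Ioc 0 t, sobolevNorm α (U (t - s) (B p j (Γ (k + p) s))) :=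
            sobolevNorm_integral_le α _
        _ ≤ ∫⁻ s in Set.Ioc 0 t, ENNReal.ofReal D *
            ENNReal.ofReal (duhamelBound M (b₀ * q * D) q (k + q) n s) := by
            refine setLIntegral_mono' measurableSet_Ioc fun s hs => ?_
            have hsT : s ∈ Set.Icc 0 T := ⟨hs.1.le, hs.2.trans ht.2⟩
            have hk' : 1 ≤ k + p := by omega
            rw [sobolevNorm_U]
            refine (sobolevNorm_B_le_contractConst hα h1 hpq' j
              ((hΓ _ hk' s hsT).trans_lt ENNReal.ofReal_lt_top)).trans ?_
            gcongr
            refine (ih _ hk' s hsT).trans (ENNReal.ofReal_le_ofReal ?_)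
            -- All orders `k + p` are raised to the common order `k + q`, so that the terms of the
            -- sum over `p` obey one recursion.
            exact duhamelBound_mono hM hL q (by omega) n hs.1.le
        _ = ENNReal.ofReal (D * X) := by
            rw [lintegral_const_mul' _ _ ENNReal.ofReal_ne_top,
              lintegral_duhamelBound hM hL q (k + q) n ht.1, ← ENNReal.ofReal_mul hDp.le]
    rw [hD k hk t ht, sobolevNorm_neg, sobolevNorm_smul, ← ofReal_norm Complex.I, Complex.norm_I,
      ENNReal.ofReal_one, one_mul, duhamelBound_succ]
    calc sobolevNorm α (∑ p ∈ Finset.Icc 1 p₀, (b p : ℂ) • ∑ j : Fin k,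
          ∫ s in (0 : ℝ)..t, U (t - s) (B p j (Γ (k + p) s)))
        ≤ ∑ p ∈ Finset.Icc 1 p₀, sobolevNorm α ((b p : ℂ) • ∑ j : Fin k,
          ∫ s in (0 : ℝ)..t, U (t - s) (B p j (Γ (k + p) s))) := sobolevNorm_sum_le _ _ _
      _ ≤ ∑ _p ∈ Finset.Icc 1 p₀, ENNReal.ofReal (b₀ * (k * (D * X))) := by
          refine Finset.sum_le_sum fun p hp => ?_
          have hp' : p ∈ Set.Icc 1 p₀ := by simpa using hp
          rw [sobolevNorm_smul, ENNReal.ofReal_mul hb₀, ← ofReal_norm, Complex.norm_real,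
            Real.norm_of_nonneg (hb0 p hp')]
          refine mul_le_mul' (ENNReal.ofReal_le_ofReal (hb p hp')) ?_
          refine (sobolevNorm_sum_le _ _ _).trans
            ((Finset.sum_le_sum fun j _ => hint p hp j).trans (le_of_eq ?_))
          rw [Finset.sum_const, Finset.card_univ, Fintype.card_fin, nsmul_eq_mul,
            ENNReal.ofReal_mul (Nat.cast_nonneg k), ENNReal.ofReal_natCast]
      _ = ENNReal.ofReal (p₀ * (b₀ * (k * (D * X)))) := by
          rw [Finset.sum_const, Nat.card_Icc, Nat.add_sub_cancel, nsmul_eq_mul,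
            ENNReal.ofReal_mul (Nat.cast_nonneg p₀), ENNReal.ofReal_natCast]
      _ ≤ ENNReal.ofReal (q * (b₀ * (k * (D * X)))) := by
          refine ENNReal.ofReal_le_ofReal ?_
          gcongr

theorem SobolevGrowth.sobolevNorm_le {K : ℝ} (h : SobolevGrowth α T K Γ) {k : ℕ} (hk : 1 ≤ k)
    {t : ℝ} (ht : t ∈ Set.Icc 0 T) : sobolevNorm α (Γ k t) ≤ ENNReal.ofReal (K ^ k) := by
  rw [sobolevNorm_eq_ofReal (h k hk t ht).1]
  exact ENNReal.ofReal_le_ofReal (h k hk t ht).2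

/-- The free terms cancel, and the rest follows from linearity of `U` and `B`; integrability of both
Duhamel integrands is what allows the integral to be split. -/
theorem IsSolution.duhamel_sub {Γ₁ Γ₂ : (k : ℕ) → ℝ → Kernel k} (hα : 1 / 2 < α) (h1 : α ≤ 1)
    (H₁ : IsSolution p₀ b α T Γ₁) (H₂ : IsSolution p₀ b α T Γ₂)
    (h0 : ∀ k, 1 ≤ k → Γ₁ k 0 = Γ₂ k 0) (k : ℕ) (hk : 1 ≤ k) (t : ℝ) (ht : t ∈ Set.Icc 0 T) :
    Γ₁ k t - Γ₂ k t = -(Complex.I • ∑ p ∈ Finset.Icc 1 p₀, (b p : ℂ) •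
      ∑ j : Fin k, ∫ s in (0 : ℝ)..t, U (t - s) (B p j (Γ₁ (k + p) s - Γ₂ (k + p) s))) := by
  have hint : ∀ p ∈ Finset.Icc 1 p₀, ∀ j : Fin k,
      ∫ s in (0 : ℝ)..t, U (t - s) (B p j (Γ₁ (k + p) s - Γ₂ (k + p) s)) =
        (∫ s in (0 : ℝ)..t, U (t - s) (B p j (Γ₁ (k + p) s))) -
          ∫ s in (0 : ℝ)..t, U (t - s) (B p j (Γ₂ (k + p) s)) := by
    intro p hp j
    rw [← intervalIntegral.integral_sub (H₁.integrable k hk p hp j t ht)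
      (H₂.integrable k hk p hp j t ht)]
    refine intervalIntegral.integral_congr fun s hs => ?_
    rw [Set.uIcc_of_le ht.1] at hs
    have hs' : s ∈ Set.Icc 0 T := ⟨hs.1, hs.2.trans ht.2⟩
    have hk' : 1 ≤ k + p := by omega
    rw [B_sub hα h1 p j (inSobolev_iff.1 (H₁.inSobolev _ hk' s hs'))
      (inSobolev_iff.1 (H₂.inSobolev _ hk' s hs')), U_sub]
  have hsum : ∑ p ∈ Finset.Icc 1 p₀, (b p : ℂ) •
      ∑ j : Fin k, ∫ s in (0 : ℝ)..t, U (t - s) (B p j (Γ₁ (k + p) s - Γ₂ (k + p) s)) =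
      (∑ p ∈ Finset.Icc 1 p₀, (b p : ℂ) •
        ∑ j : Fin k, ∫ s in (0 : ℝ)..t, U (t - s) (B p j (Γ₁ (k + p) s))) -
      ∑ p ∈ Finset.Icc 1 p₀, (b p : ℂ) •
        ∑ j : Fin k, ∫ s in (0 : ℝ)..t, U (t - s) (B p j (Γ₂ (k + p) s)) := by
    rw [← Finset.sum_sub_distrib]
    refine Finset.sum_congr rfl fun p hp => ?_
    rw [← smul_sub, ← Finset.sum_sub_distrib]
    exact congrArg _ (Finset.sum_congr rfl fun j _ => hint p hp j)
  rw [hsum, H₁.duhamel k hk t ht, H₂.duhamel k hk t ht, h0 k hk, smul_sub]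
  abel

end Duhamel

theorem eq_zero_of_forall_norm_S_le {ι : Type} [Fintype ι] {α c r : ℝ} {g : L2 ι}
    (hg : InSobolev α g) (hr0 : 0 ≤ r) (hr : r < 1) (h : ∀ n : ℕ, ‖S α g‖ ≤ c * r ^ n) :
    g = 0 := by
  have ht := (tendsto_pow_atTop_nhds_zero_of_lt_one hr0 hr).const_mul c
  rw [mul_zero] at ht
  have : ‖S α g‖ = 0 := le_antisymm (ge_of_tendsto' ht h) (norm_nonneg _)
  refine eq_zero_of_sobolevNorm (α := α) ?_
  rw [sobolevNorm_eq_ofReal hg, this, ENNReal.ofReal_zero]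

end GPHierarchy

end

/-! ### Choice of the constants and conclusion. -/

open GPHierarchy

theorem theorem5p1 (p₀ : ℕ) (α b₀ K : ℝ) (hα : 1 / 2 < α) (hα' : α ≤ 1) (hb₀ : 0 < b₀)
    (hK : 0 < K) :
    ∃ C C₀ : ℝ, 0 < C ∧ 0 < C₀ ∧
      ∀ b : ℕ → ℝ, (∀ p ∈ Set.Icc 1 p₀, 0 ≤ b p) → IsGreatest (b '' Set.Icc 1 p₀) b₀ →
      ∀ T : ℝ, 0 < T →
        (∀ Γ : (k : ℕ) → ℝ → Kernel k,
          IsSolution p₀ b α T Γ → SobolevGrowth α T K Γ → (∀ k, 1 ≤ k → Γ k 0 = 0) →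
          (∀ k, 1 ≤ k → ∀ t ∈ Set.Icc 0 T, ∀ n : ℕ, ‖S α (Γ k t)‖ ≤ C ^ k * (C₀ * T) ^ n) ∧
          (C₀ * T < 1 → ∀ k, 1 ≤ k → ∀ t ∈ Set.Icc 0 T, Γ k t = 0)) ∧
        (∀ Γ₁ Γ₂ : (k : ℕ) → ℝ → Kernel k,
          IsSolution p₀ b α T Γ₁ → IsSolution p₀ b α T Γ₂ →
          (SobolevGrowth α T K Γ₁ ∧ SobolevGrowth α T K Γ₂ ∨
            EnergyGrowth T K Γ₁ ∧ EnergyGrowth T K Γ₂) →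
          (∀ k, 1 ≤ k → Γ₁ k 0 = Γ₂ k 0) →
          (∀ k, 1 ≤ k → ∀ t ∈ Set.Icc 0 T, ∀ n : ℕ,
            InSobolev α (Γ₁ k t - Γ₂ k t) ∧
              ‖S α (Γ₁ k t - Γ₂ k t)‖ ≤ C ^ k * (C₀ * T) ^ n) ∧
          (C₀ * T < 1 → ∀ k, 1 ≤ k → ∀ t ∈ Set.Icc 0 T, Γ₁ k t = Γ₂ k t)) := by
  -- Taking `p₀ + 1` rather than `p₀` keeps the constants positive even for `p₀ = 0`, a case
  -- excluded only later, by the existence of a maximal coefficient.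
  set q := p₀ + 1 with hq
  -- The factor `2` accommodates the difference of two solutions, as `2K^k ≤ (2K)^k` for `k ≥ 1`; `M
  -- ≥ 1` makes the bounds monotone in the order.
  set M := max 1 (2 * K) with hM
  set L := b₀ * q * contractConst α q with hL
  have hD := contractConst_pos α q
  have hM1 : 1 ≤ M := le_max_left _ _
  have hq0 : (0 : ℝ) < q := by positivity
  have hL0 : 0 < L := by positivity
  have hC₀ : 0 < 2 * M ^ q * L * q := by positivity
  have hKM : ∀ k, 1 ≤ k → K ^ k + K ^ k ≤ M ^ k := fun k hk => by
    calc K ^ k + K ^ k = 2 * K ^ k := by ring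
      _ ≤ 2 ^ k * K ^ k := by
        gcongr
        exact le_self_pow₀ one_le_two (by omega)
      _ = (2 * K) ^ k := (mul_pow _ _ _).symm
      _ ≤ M ^ k := by
        gcongr
        exact le_max_right _ _
  -- Both constants are read off from `duhamelBound_le`.
  refine ⟨2 * M, 2 * M ^ q * L * q, by positivity, hC₀, fun b hb0 hb T hT => ?_⟩
  have hble : ∀ p ∈ Set.Icc 1 p₀, b p ≤ b₀ := fun p hp => hb.2 ⟨p, hp, rfl⟩
  have main : ∀ Γ : (k : ℕ) → ℝ → Kernel k,
      (∀ k, 1 ≤ k → ∀ t ∈ Set.Icc 0 T, sobolevNorm α (Γ k t) ≤ ENNReal.ofReal (M ^ k)) →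
      (∀ k, 1 ≤ k → ∀ t ∈ Set.Icc 0 T, Γ k t = -(Complex.I • ∑ p ∈ Finset.Icc 1 p₀,
        (b p : ℂ) • ∑ j : Fin k, ∫ s in (0 : ℝ)..t, U (t - s) (B p j (Γ (k + p) s)))) →
      (∀ k, 1 ≤ k → ∀ t ∈ Set.Icc 0 T, ∀ n : ℕ, InSobolev α (Γ k t) ∧
        ‖S α (Γ k t)‖ ≤ (2 * M) ^ k * (2 * M ^ q * L * q * T) ^ n) ∧
      (2 * M ^ q * L * q * T < 1 → ∀ k, 1 ≤ k → ∀ t ∈ Set.Icc 0 T, Γ k t = 0) := by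
    intro Γ hΓ hdu
    have hbd : ∀ k, 1 ≤ k → ∀ t ∈ Set.Icc 0 T, ∀ n : ℕ, InSobolev α (Γ k t) ∧
        ‖S α (Γ k t)‖ ≤ (2 * M) ^ k * (2 * M ^ q * L * q * T) ^ n := fun k hk t ht n =>
      ⟨inSobolev_of_le (hΓ k hk t ht), norm_S_le (by positivity)
        ((sobolevNorm_le_duhamelBound hα hα' hM1 (Nat.le_succ p₀) hb0 hble hb₀.le hΓ hdu n k hk t
          ht).trans (ENNReal.ofReal_le_ofReal
            (duhamelBound_le hM1 hL0.le ht.1 ht.2 (Nat.succ_pos p₀) n)))⟩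
    exact ⟨hbd, fun hlt k hk t ht => eq_zero_of_forall_norm_S_le (hbd k hk t ht 0).1
      (by positivity) hlt fun n => (hbd k hk t ht n).2⟩
  constructor
  · intro Γ hΓ hgr h0
    obtain ⟨m1, m2⟩ := main Γ
      (fun k hk t ht => (hgr.sobolevNorm_le hk ht).trans (ENNReal.ofReal_le_ofReal
        ((le_add_of_nonneg_left (by positivity)).trans (hKM k hk))))
      (fun k hk t ht => by
        -- The missing free term is reinstated as the evolution of the zero initial datum.
        rw [← zero_sub, ← U_zero t, ← h0 k hk]
        exact hΓ.duhamel k hk t ht)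
    exact ⟨fun k hk t ht n => (m1 k hk t ht n).2, m2⟩
  · intro Γ₁ Γ₂ H₁ H₂ hgr h0
    have hbound : ∀ k, 1 ≤ k → ∀ t ∈ Set.Icc 0 T,
        sobolevNorm α (Γ₁ k t) ≤ ENNReal.ofReal (K ^ k) ∧
          sobolevNorm α (Γ₂ k t) ≤ ENNReal.ofReal (K ^ k) := by
      intro k hk t ht
      rcases hgr with ⟨g1, g2⟩ | ⟨g1, g2⟩
      · exact ⟨g1.sobolevNorm_le hk ht, g2.sobolevNorm_le hk ht⟩
      · exact ⟨(g1 k hk t ht).sobolevNorm_le hα hα', (g2 k hk t ht).sobolevNorm_le hα hα'⟩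
    obtain ⟨m1, m2⟩ := main (fun k t => Γ₁ k t - Γ₂ k t)
      (fun k hk t ht => by
        refine (sobolevNorm_sub_le α _ _).trans ((add_le_add (hbound k hk t ht).1
          (hbound k hk t ht).2).trans ?_)
        rw [← ENNReal.ofReal_add (by positivity) (by positivity)]
        exact ENNReal.ofReal_le_ofReal (hKM k hk))
      (fun k hk t ht => H₁.duhamel_sub hα hα' H₂ h0 k hk t ht)
    exact ⟨m1, fun hlt k hk t ht => sub_eq_zero.1 (m2 hlt k hk t ht)⟩
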